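/- Let $R(s)$ be an $n\times n$ matrix of real rational functions and let $A\in\mathbb{R}^{k\times k}$, $B\in\mathbb{R}^{k\times n}$, $C\in\mathbb{R}^{n\times k}$, $D\in\mathbb{R}^{n\times n}$ be a minimal state-space realisation of $R(s)$, i.e. $R(s)=C(sI-A)^{-1}B+D$ and no real realisation of $R(s)$ has a smaller state dimension. Let $\mathscr{C}$ be the set of all $n\times n$ real-rational stable transfer matrices $R(s)$ (every entry proper, with all poles in the open left half plane) such that $j[R(j\omega)-R(j\omega)^*]\ge 0$ (Hermitian positive semidefinite) for all $\omega\in(0,\infty)$. Then $R(s)\in\mathscr{C}$ if and only if $A$ is Hurwitz (all eigenvalues have negative real part), $D=D^*$, and there exists a real symmetric positive definite matrix $Y\in\mathbb{R}^{k\times k}$ such that \[ AY+YA^*\le 0 \quad\text{and}\quad B=-AYC^*. \] -/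

import Mathlib

open scoped Matrix ComplexOrder

noncomputable section

namespace NegImag

/-- A real matrix is Hurwitz if all its complex eigenvalues lie in the open left half plane. -/
def IsHurwitz {k : ℕ} (A : Matrix (Fin k) (Fin k) ℝ) : Prop :=
  ∀ s ∈ spectrum ℂ (A.map ((↑) : ℝ → ℂ)), s.re < 0

/-- The real-rational matrix `C (s I - A)⁻¹ B + D`, where `s` is the indeterminate `RatFunc.X`. -/
def transferMatrix {k p q : ℕ} (A : Matrix (Fin k) (Fin k) ℝ) (B : Matrix (Fin k) (Fin q) ℝ)
    (C : Matrix (Fin p) (Fin k) ℝ) (D : Matrix (Fin p) (Fin q) ℝ) :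
    Matrix (Fin p) (Fin q) (RatFunc ℝ) :=
  C.map RatFunc.C * ((RatFunc.X : RatFunc ℝ) • 1 - A.map RatFunc.C)⁻¹ * B.map RatFunc.C
    + D.map RatFunc.C

/-- `(A, B, C, D)` is a (real) state-space realisation of the transfer matrix `R`. -/
def IsRealisation {k p q : ℕ} (A : Matrix (Fin k) (Fin k) ℝ) (B : Matrix (Fin k) (Fin q) ℝ)
    (C : Matrix (Fin p) (Fin k) ℝ) (D : Matrix (Fin p) (Fin q) ℝ)
    (R : Matrix (Fin p) (Fin q) (RatFunc ℝ)) : Prop :=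
  R = transferMatrix A B C D

/-- A realisation is minimal if no realisation of the same transfer matrix has a smaller
state dimension. -/
def IsMinimalRealisation {k p q : ℕ} (A : Matrix (Fin k) (Fin k) ℝ) (B : Matrix (Fin k) (Fin q) ℝ)
    (C : Matrix (Fin p) (Fin k) ℝ) (D : Matrix (Fin p) (Fin q) ℝ)
    (R : Matrix (Fin p) (Fin q) (RatFunc ℝ)) : Prop :=
  IsRealisation A B C D R ∧
    ∀ (k' : ℕ) (A' : Matrix (Fin k') (Fin k') ℝ) (B' : Matrix (Fin k') (Fin q) ℝ)
      (C' : Matrix (Fin p) (Fin k') ℝ) (D' : Matrix (Fin p) (Fin q) ℝ),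
      IsRealisation A' B' C' D' R → k ≤ k'

/-- The set of real-rational stable transfer matrices: every entry is proper
and, in lowest terms, all its complex poles lie in the open left half plane. -/
def RHInf (n : ℕ) : Set (Matrix (Fin n) (Fin n) (RatFunc ℝ)) :=
  {R | ∀ i j, (R i j).num.natDegree ≤ (R i j).denom.natDegree ∧
    ∀ s : ℂ, Polynomial.aeval s (R i j).denom = 0 → s.re < 0}

/-- The value `R(s)` of a real-rational matrix at a complex number `s` (entrywise; meaningful
when `s` is not a pole of any entry). -/
def evalAt {n : ℕ} (R : Matrix (Fin n) (Fin n) (RatFunc ℝ)) (s : ℂ) : Matrix (Fin n) (Fin n) ℂ :=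
  R.map (RatFunc.eval (algebraMap ℝ ℂ) s)

/-- Stable systems with negative imaginary frequency response:
`R` is real-rational stable and `j [R(jω) - R(jω)*] ≥ 0` for all `ω ∈ (0, ∞)`. -/
def ClassC (n : ℕ) : Set (Matrix (Fin n) (Fin n) (RatFunc ℝ)) :=
  {R | R ∈ RHInf n ∧ ∀ ω : ℝ, 0 < ω →
    (Complex.I • (evalAt R (Complex.I * ω) - (evalAt R (Complex.I * ω))ᴴ)).PosSemidef}

end NegImag

end

namespace NegImag

open Matrix Filter Topology Polynomial

/-! The proof divides out the value at the origin. For Hurwitz `A`, R(s) = R(0) - s G(s) with R(0) =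
D - C A⁻¹ B and G(s) = C (sI - A)⁻¹ (-A⁻¹B). If R(0) is symmetric, then j[R(jω) - R(jω)*] = ω [G(jω)
+ G(jω)*], so the negative imaginary property becomes positive realness of G. The limits ω → ∞ and ω
→ 0 force D and R(0) to be symmetric. The positive real lemma (`IsPositiveReal.exists_posDef`),
applied to the transpose of G, then gives Y > 0 with AY + YAᵀ ≤ 0 and YCᵀ = -A⁻¹B. Conversely, such
a Y makes G + G* a congruence of -(AY + YAᵀ) (`posSemidef_freqResponse`).

Minimality enters as controllability of (A, B) and of (Aᵀ, Cᵀ). These show that every eigenvalue of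
A is a pole of R, so stability of R makes A Hurwitz.

The positive real lemma is proved by conic duality. If no symmetric X satisfies XA + AᵀX ≤ 0 and XB
= Cᵀ, Farkas' lemma yields W ≥ 0 and Z with AW + WAᵀ + BZ + ZᵀBᵀ = 0 and tr(ZCᵀ) < 0. For W > 0 and
K = ZW⁻¹, the matrix A + BK is skew with respect to W, so its eigenvectors q have imaginary
eigenvalues jω and satisfy Cq = G(jω)Kq. Hence tr(ZCᵀ) is a sum of values of the form of G, with
nonnegative real part, a contradiction. Singular W is reached by perturbing with the controllability
Gramian. -/

/-- The pair `(A, B)` is controllable: the only `A`-invariant subspace containing all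
columns of `B` is the whole state space. -/
def IsControllable {k q : ℕ} (A : Matrix (Fin k) (Fin k) ℝ) (B : Matrix (Fin k) (Fin q) ℝ) : Prop :=
  ∀ V : Submodule ℝ (Fin k → ℝ), (∀ j, B.col j ∈ V) → (∀ v ∈ V, A *ᵥ v ∈ V) → V = ⊤

/-! ### Realisations: minimality, poles and evaluation. -/

section Realisation

variable {k p q : ℕ}

theorem charmatrix_map_ratFunc (A : Matrix (Fin k) (Fin k) ℝ) :
    A.charmatrix.map (algebraMap ℝ[X] (RatFunc ℝ)) =
      (RatFunc.X : RatFunc ℝ) • 1 - A.map RatFunc.C := by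
  ext i j
  by_cases h : i = j
  · subst h; simp [charmatrix_apply_eq]
  · simp [h]

theorem det_resolvent_ratFunc (A : Matrix (Fin k) (Fin k) ℝ) :
    ((RatFunc.X : RatFunc ℝ) • 1 - A.map RatFunc.C).det =
      algebraMap ℝ[X] (RatFunc ℝ) A.charpoly := by
  rw [← charmatrix_map_ratFunc, Matrix.charpoly, RingHom.map_det, RingHom.mapMatrix_apply]

theorem isUnit_det_resolvent_ratFunc (A : Matrix (Fin k) (Fin k) ℝ) :
    IsUnit ((RatFunc.X : RatFunc ℝ) • 1 - A.map RatFunc.C).det := by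
  rw [det_resolvent_ratFunc, isUnit_iff_ne_zero]
  exact RatFunc.algebraMap_ne_zero A.charpoly_monic.ne_zero

/-- `T` also intertwines the two resolvents. It need not be square, which allows passing to an
invariant subspace. -/
theorem transferMatrix_eq_of_intertwining {k' : ℕ} {A : Matrix (Fin k) (Fin k) ℝ}
    {B : Matrix (Fin k) (Fin q) ℝ} {C : Matrix (Fin p) (Fin k) ℝ} {D : Matrix (Fin p) (Fin q) ℝ}
    {A' : Matrix (Fin k') (Fin k') ℝ} {B' : Matrix (Fin k') (Fin q) ℝ}
    (T : Matrix (Fin k) (Fin k') ℝ) (hA : A * T = T * A') (hB : B = T * B') :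
    transferMatrix A B C D = transferMatrix A' B' (C * T) D := by
  have h1 := isUnit_det_resolvent_ratFunc A
  have h2 := isUnit_det_resolvent_ratFunc A'
  have hT : ((RatFunc.X : RatFunc ℝ) • 1 - A.map RatFunc.C) * T.map RatFunc.C =
      T.map RatFunc.C * ((RatFunc.X : RatFunc ℝ) • 1 - A'.map RatFunc.C) := by
    rw [Matrix.sub_mul, Matrix.mul_sub, ← Matrix.map_mul, ← Matrix.map_mul, hA]
    simp
  have hR : ((RatFunc.X : RatFunc ℝ) • 1 - A.map RatFunc.C)⁻¹ * T.map RatFunc.C =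
      T.map RatFunc.C * ((RatFunc.X : RatFunc ℝ) • 1 - A'.map RatFunc.C)⁻¹ := by
    calc _ = ((RatFunc.X : RatFunc ℝ) • 1 - A.map RatFunc.C)⁻¹ * (T.map RatFunc.C *
          ((RatFunc.X : RatFunc ℝ) • 1 - A'.map RatFunc.C)) *
            ((RatFunc.X : RatFunc ℝ) • 1 - A'.map RatFunc.C)⁻¹ := by
          rw [Matrix.mul_assoc, Matrix.mul_assoc, Matrix.mul_nonsing_inv _ h2, Matrix.mul_one]
      _ = _ := by
          rw [← hT, ← Matrix.mul_assoc, Matrix.nonsing_inv_mul _ h1, Matrix.one_mul]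
  unfold transferMatrix
  rw [hB, Matrix.map_mul, Matrix.map_mul]
  simp only [Matrix.mul_assoc]
  rw [← Matrix.mul_assoc _ (T.map _) (B'.map _), hR, Matrix.mul_assoc]

/-- In a basis of `V`, the restriction of `A` to `V` gives a realisation of dimension `finrank V`,
so minimality leaves no room for a proper subspace. -/
theorem IsMinimalRealisation.isControllable {A : Matrix (Fin k) (Fin k) ℝ}
    {B : Matrix (Fin k) (Fin q) ℝ} {C : Matrix (Fin p) (Fin k) ℝ} {D : Matrix (Fin p) (Fin q) ℝ}
    {R : Matrix (Fin p) (Fin q) (RatFunc ℝ)} (h : IsMinimalRealisation A B C D R) :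
    IsControllable A B := by
  intro V hB hA
  let b := Module.finBasis ℝ V
  let T : Matrix (Fin k) (Fin (Module.finrank ℝ V)) ℝ := Matrix.of fun i j => (b j : Fin k → ℝ) i
  have hT : ∀ v (hv : v ∈ V), T *ᵥ (b.repr ⟨v, hv⟩) = v := by
    intro v hv
    have := congrArg (Subtype.val) (b.sum_repr ⟨v, hv⟩)
    rw [Submodule.coe_sum] at this
    conv_rhs => rw [← show _ = v from this]
    ext i
    simp [T, Matrix.mulVec, dotProduct, mul_comm]
  have hb : ∀ j, (b j : Fin k → ℝ) = T.col j := fun j => rfl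
  let A' : Matrix (Fin (Module.finrank ℝ V)) (Fin (Module.finrank ℝ V)) ℝ :=
    Matrix.of fun i j => b.repr ⟨A *ᵥ (b j), hA _ (b j).2⟩ i
  let B' : Matrix (Fin (Module.finrank ℝ V)) (Fin q) ℝ := Matrix.of fun i j => b.repr ⟨_, hB j⟩ i
  have hAT : A * T = T * A' := by
    ext i j
    have := congrFun (hT _ (hA _ (b j).2)) i
    exact this.symm
  have hBT : B = T * B' := by
    ext i j
    exact (congrFun (hT _ (hB j)) i).symm
  have hk := h.2 _ A' B' (C * T) D
    (h.1.trans (transferMatrix_eq_of_intertwining T hAT hBT))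
  apply Submodule.eq_top_of_finrank_eq
  refine le_antisymm (Submodule.finrank_le V) ?_
  simpa using hk

theorem transferMatrix_transpose (A : Matrix (Fin k) (Fin k) ℝ)
    (B : Matrix (Fin k) (Fin q) ℝ) (C : Matrix (Fin p) (Fin k) ℝ) (D : Matrix (Fin p) (Fin q) ℝ) :
    (transferMatrix A B C D)ᵀ = transferMatrix Aᵀ Cᵀ Bᵀ Dᵀ := by
  simp [transferMatrix, Matrix.transpose_nonsing_inv, Matrix.mul_assoc, Matrix.transpose_map]

theorem IsMinimalRealisation.transpose {A : Matrix (Fin k) (Fin k) ℝ}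
    {B : Matrix (Fin k) (Fin q) ℝ} {C : Matrix (Fin p) (Fin k) ℝ} {D : Matrix (Fin p) (Fin q) ℝ}
    {R : Matrix (Fin p) (Fin q) (RatFunc ℝ)} (h : IsMinimalRealisation A B C D R) :
    IsMinimalRealisation Aᵀ Cᵀ Bᵀ Dᵀ Rᵀ := by
  refine ⟨(congrArg Matrix.transpose h.1).trans (transferMatrix_transpose A B C D), ?_⟩
  intro k' A' B' C' D' h'
  refine h.2 k' A'ᵀ C'ᵀ B'ᵀ D'ᵀ ?_
  have := congrArg Matrix.transpose h'
  rwa [transferMatrix_transpose, Matrix.transpose_transpose] at this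

/-- The real rational functions that have no pole at `s`. -/
def regularAt (s : ℂ) : Subring (RatFunc ℝ) where
  carrier := {f | aeval s f.denom ≠ 0}
  mul_mem' {f g} hf hg h := by
    obtain ⟨r, hr⟩ := RatFunc.denom_mul_dvd f g
    have := congrArg (aeval s) hr
    rw [map_mul, map_mul, h, zero_mul] at this
    exact mul_ne_zero hf hg this
  one_mem' := by simp
  add_mem' {f g} hf hg h := by
    obtain ⟨r, hr⟩ := RatFunc.denom_add_dvd f g
    have := congrArg (aeval s) hr
    rw [map_mul, map_mul, h, zero_mul] at this
    exact mul_ne_zero hf hg this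
  zero_mem' := by simp
  neg_mem' {f} hf h := by
    have h1 : (-f).denom ∣ f.denom := by
      have := RatFunc.denom_mul_dvd (RatFunc.C (-1)) f
      rwa [show RatFunc.C (-1 : ℝ) * f = -f by simp, RatFunc.denom_C, one_mul] at this
    obtain ⟨r, hr⟩ := h1
    have := congrArg (aeval s) hr
    rw [map_mul, h, zero_mul] at this
    exact hf this

theorem mem_regularAt {s : ℂ} {f : RatFunc ℝ} : f ∈ regularAt s ↔ aeval s f.denom ≠ 0 := Iff.rfl

theorem C_mem_regularAt (s : ℂ) (r : ℝ) : RatFunc.C r ∈ regularAt s := by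
  simp [mem_regularAt]

theorem X_mem_regularAt (s : ℂ) : RatFunc.X ∈ regularAt s := by
  simp [mem_regularAt]

/-- Evaluation at `s` of rational functions that have no pole at `s`. -/
noncomputable def evalRegular (s : ℂ) : regularAt s →+* ℂ where
  toFun f := RatFunc.eval (algebraMap ℝ ℂ) s f
  map_one' := by simp
  map_zero' := by simp
  map_mul' f g := RatFunc.eval_mul _ _ f.2 g.2
  map_add' f g := RatFunc.eval_add _ _ f.2 g.2

theorem evalRegular_C (s : ℂ) (r : ℝ) : evalRegular s ⟨RatFunc.C r, C_mem_regularAt s r⟩ = r := by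
  simp [evalRegular]

theorem evalRegular_X (s : ℂ) : evalRegular s ⟨RatFunc.X, X_mem_regularAt s⟩ = s := by
  simp [evalRegular]

/-- The identity between resolvent and `X - A` already holds over the subring `regularAt s`, on
which evaluation is a ring homomorphism. -/
theorem eval_mul_resolvent_eq_one {s : ℂ} {A : Matrix (Fin k) (Fin k) ℝ}
    (h : ∀ i j, ((RatFunc.X : RatFunc ℝ) • 1 - A.map RatFunc.C)⁻¹ i j ∈ regularAt s) :
    ((RatFunc.X : RatFunc ℝ) • 1 - A.map RatFunc.C)⁻¹.map (RatFunc.eval (algebraMap ℝ ℂ) s) *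
      (s • 1 - A.map (algebraMap ℝ ℂ)) = 1 := by
  let M : Matrix (Fin k) (Fin k) (regularAt s) := Matrix.of fun i j => ⟨_, h i j⟩
  let N : Matrix (Fin k) (Fin k) (regularAt s) :=
    (⟨RatFunc.X, X_mem_regularAt s⟩ : regularAt s) • 1 -
      Matrix.of fun i j => ⟨RatFunc.C (A i j), C_mem_regularAt s _⟩
  have hMN : M * N = 1 := by
    apply Matrix.map_injective (f := (regularAt s).subtype) Subtype.val_injective
    dsimp only
    rw [Matrix.map_mul]
    have h1 : M.map (regularAt s).subtype =
      ((RatFunc.X : RatFunc ℝ) • 1 - A.map RatFunc.C)⁻¹ := rfl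
    have h2 : N.map (regularAt s).subtype =
      (RatFunc.X : RatFunc ℝ) • 1 - A.map RatFunc.C := by
      ext i j
      by_cases hij : i = j
      · subst hij; simp [N]
      · simp [N, hij]
    rw [h1, h2, Matrix.nonsing_inv_mul _ (isUnit_det_resolvent_ratFunc A)]
    simp
  have := congrArg (fun M => M.map (evalRegular s)) hMN
  simp only [Matrix.map_mul] at this
  have h1 : M.map (evalRegular s) = ((RatFunc.X : RatFunc ℝ) • 1 - A.map RatFunc.C)⁻¹.map
    (RatFunc.eval (algebraMap ℝ ℂ) s) := rfl
  have h2 : N.map (evalRegular s) = s • 1 - A.map (algebraMap ℝ ℂ) := by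
    ext i j
    by_cases hij : i = j
    · subst hij; simp [N, evalRegular_C, evalRegular_X]
    · simp [N, evalRegular_C, hij]
  rw [h1, h2] at this
  rw [this]; simp

/-- The real vectors `v` with `M Φ v` over `K` form a subspace containing the columns of `B`. It is
`A`-invariant because `Φ A = X Φ - 1`, so controllability makes it everything and `B` can be
cancelled. -/
theorem resolvent_mul_mem_of_isControllable {K : Subring (RatFunc ℝ)}
    (hC : ∀ r : ℝ, RatFunc.C r ∈ K) (hX : RatFunc.X ∈ K) {A : Matrix (Fin k) (Fin k) ℝ}
    {B : Matrix (Fin k) (Fin q) ℝ} (hAB : IsControllable A B)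
    {M : Matrix (Fin p) (Fin k) ℝ}
    (h : ∀ i j, (M.map RatFunc.C * ((RatFunc.X : RatFunc ℝ) • 1 - A.map RatFunc.C)⁻¹ *
      B.map RatFunc.C) i j ∈ K) (i : Fin p) (j : Fin k) :
    (M.map RatFunc.C * ((RatFunc.X : RatFunc ℝ) • 1 - A.map RatFunc.C)⁻¹) i j ∈ K := by
  set Φ := ((RatFunc.X : RatFunc ℝ) • 1 - A.map RatFunc.C)⁻¹ with hΦ
  let V : Submodule ℝ (Fin k → ℝ) :=
    { carrier := {v | ∀ i, ((M.map RatFunc.C * Φ) *ᵥ (RatFunc.C ∘ v)) i ∈ K}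
      zero_mem' := by
        intro i
        have : (RatFunc.C ∘ (0 : Fin k → ℝ)) = 0 := by ext; simp
        rw [this, Matrix.mulVec_zero]; exact K.zero_mem
      add_mem' := by
        intro v w hv hw i
        have : (RatFunc.C ∘ (v + w)) = RatFunc.C ∘ v + RatFunc.C ∘ w := by ext; simp
        rw [this, Matrix.mulVec_add]; exact K.add_mem (hv i) (hw i)
      smul_mem' := by
        intro c v hv i
        have : (RatFunc.C ∘ (c • v)) = RatFunc.C c • RatFunc.C ∘ v := by ext; simp
        rw [this, Matrix.mulVec_smul]; exact K.mul_mem (hC c) (hv i) }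
  have hV : V = ⊤ := by
    apply hAB
    · intro j i
      exact h i j
    · intro v hv i
      have h1 : RatFunc.C ∘ (A *ᵥ v) = A.map RatFunc.C *ᵥ (RatFunc.C ∘ v) := by
        ext i; simp [Matrix.mulVec, dotProduct]
      have h2 : Φ * A.map RatFunc.C = (RatFunc.X : RatFunc ℝ) • Φ - 1 := by
        have := Matrix.nonsing_inv_mul _ (isUnit_det_resolvent_ratFunc A)
        rw [← hΦ, Matrix.mul_sub] at this
        rw [← this]; simp
      rw [h1, Matrix.mulVec_mulVec, Matrix.mul_assoc, h2, Matrix.mul_sub, Matrix.sub_mulVec]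
      refine K.sub_mem ?_ ?_
      · rw [Matrix.mul_smul, Matrix.smul_mulVec]
        exact K.mul_mem hX (hv i)
      · rw [Matrix.mul_one]
        simp only [Matrix.mulVec, dotProduct, Matrix.map_apply, Function.comp_apply]
        exact K.sum_mem fun l _ => K.mul_mem (hC _) (hC _)
  have : Pi.single j 1 ∈ V := hV ▸ Submodule.mem_top
  have h3 := this i
  have h4 : RatFunc.C ∘ (Pi.single j 1 : Fin k → ℝ) = Pi.single j 1 := by
    ext l; by_cases hl : l = j
    · subst hl; simp
    · simp [hl]
  rwa [h4, Matrix.mulVec_single_one] at h3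

theorem resolvent_mem_of_minimal {K : Subring (RatFunc ℝ)}
    (hC : ∀ r : ℝ, RatFunc.C r ∈ K) (hX : RatFunc.X ∈ K) {A : Matrix (Fin k) (Fin k) ℝ}
    {B : Matrix (Fin k) (Fin q) ℝ} {C : Matrix (Fin p) (Fin k) ℝ} {D : Matrix (Fin p) (Fin q) ℝ}
    (hAB : IsControllable A B) (hAC : IsControllable Aᵀ Cᵀ)
    (h : ∀ i j, transferMatrix A B C D i j ∈ K) (i j : Fin k) :
    ((RatFunc.X : RatFunc ℝ) • 1 - A.map RatFunc.C)⁻¹ i j ∈ K := by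
  have h1 : ∀ i j, (C.map RatFunc.C * ((RatFunc.X : RatFunc ℝ) • 1 - A.map RatFunc.C)⁻¹ *
      B.map RatFunc.C) i j ∈ K := by
    intro i j
    have := K.sub_mem (h i j) (hC (D i j))
    simpa [transferMatrix] using this
  have h2 := resolvent_mul_mem_of_isControllable hC hX hAB h1
  have hT : ((RatFunc.X : RatFunc ℝ) • 1 - Aᵀ.map RatFunc.C)⁻¹ =
      (((RatFunc.X : RatFunc ℝ) • 1 - A.map RatFunc.C)⁻¹)ᵀ := by
    simp [Matrix.transpose_nonsing_inv, Matrix.transpose_map]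
  -- With `B` gone, the same cancellation for the transposed system removes `C`.
  have h3 := resolvent_mul_mem_of_isControllable hC hX hAC (M := 1) (p := k) (by
    intro i j
    have e : (1 : Matrix (Fin k) (Fin k) ℝ).map RatFunc.C *
        ((RatFunc.X : RatFunc ℝ) • 1 - Aᵀ.map RatFunc.C)⁻¹ * Cᵀ.map RatFunc.C =
        (C.map RatFunc.C * ((RatFunc.X : RatFunc ℝ) • 1 - A.map RatFunc.C)⁻¹)ᵀ := by
      rw [hT]; simp [Matrix.transpose_map]
    rw [e]
    exact h2 j i) j i
  rw [hT] at h3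
  simpa using h3

theorem isHurwitz_iff {A : Matrix (Fin k) (Fin k) ℝ} :
    IsHurwitz A ↔ ∀ s : ℂ, 0 ≤ s.re → IsUnit (s • 1 - A.map (algebraMap ℝ ℂ)) := by
  unfold IsHurwitz
  refine forall_congr' fun s => ?_
  rw [spectrum.mem_iff, Algebra.algebraMap_eq_smul_one, ← not_le]
  change (¬ IsUnit (s • 1 - A.map (algebraMap ℝ ℂ)) → _) ↔ _
  tauto

theorem IsHurwitz.transpose {A : Matrix (Fin k) (Fin k) ℝ} (h : IsHurwitz A) : IsHurwitz Aᵀ := by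
  rw [isHurwitz_iff] at h ⊢
  intro s hs
  rw [← Matrix.isUnit_transpose]
  simpa [Matrix.transpose_map] using h s hs

theorem IsHurwitz.isUnit_det {A : Matrix (Fin k) (Fin k) ℝ} (h : IsHurwitz A) : IsUnit A.det := by
  have := isHurwitz_iff.1 h 0 (by simp)
  rw [zero_smul, zero_sub, IsUnit.neg_iff, Matrix.isUnit_iff_isUnit_det,
    ← RingHom.mapMatrix_apply, ← RingHom.map_det, isUnit_iff_ne_zero] at this
  rw [isUnit_iff_ne_zero]
  exact fun h => this (by simp [h])

/-- If `R` has no pole at `s`, neither has the resolvent; its value there inverts `s - A`. -/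
theorem IsMinimalRealisation.isHurwitz {n : ℕ} {A : Matrix (Fin k) (Fin k) ℝ}
    {B : Matrix (Fin k) (Fin n) ℝ} {C : Matrix (Fin n) (Fin k) ℝ} {D : Matrix (Fin n) (Fin n) ℝ}
    {R : Matrix (Fin n) (Fin n) (RatFunc ℝ)} (h : IsMinimalRealisation A B C D R)
    (hR : R ∈ RHInf n) : IsHurwitz A := by
  rw [isHurwitz_iff]
  intro s hs
  have hreg := resolvent_mem_of_minimal (C_mem_regularAt s) (X_mem_regularAt s)
    h.isControllable h.transpose.isControllable (D := D) (B := B) (fun i j => by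
      rw [mem_regularAt, ← h.1]
      exact fun h0 => absurd ((hR i j).2 s h0) (not_lt.2 hs))
  exact IsUnit.of_mul_eq_one_right _ (eval_mul_resolvent_eq_one hreg)

/-- Every entry of a transfer matrix is a quotient of a polynomial of degree at most `k` by the
characteristic polynomial of the state matrix. -/
theorem exists_transferMatrix_apply_eq_div (A : Matrix (Fin k) (Fin k) ℝ)
    (B : Matrix (Fin k) (Fin q) ℝ) (C : Matrix (Fin p) (Fin k) ℝ) (D : Matrix (Fin p) (Fin q) ℝ)
    (i : Fin p) (j : Fin q) :
    ∃ r : ℝ[X], r.natDegree ≤ A.charpoly.natDegree ∧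
      transferMatrix A B C D i j =
        algebraMap ℝ[X] (RatFunc ℝ) r / algebraMap ℝ[X] (RatFunc ℝ) A.charpoly := by
  -- An adjugate entry is a determinant whose entries have degree at most one. The crude bound `k`
  -- in place of `k - 1` suffices for properness.
  have hadj : ∀ i j, (A.charmatrix.adjugate i j).natDegree ≤ k := by
    intro i j
    rw [Matrix.adjugate_apply, Matrix.det_apply]
    refine natDegree_sum_le_of_forall_le _ _ fun σ _ => ?_
    refine (natDegree_smul_le _ _).trans ((natDegree_prod_le _ _).trans ?_)
    refine (Finset.sum_le_card_nsmul _ _ 1 fun l _ => ?_).trans (by simp)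
    rw [Matrix.updateRow_apply]
    split_ifs
    · by_cases hh : σ l = i <;> by_cases h2 : l = i <;> simp [Pi.single_apply] <;>
        split_ifs <;> simp
    · rw [Matrix.charmatrix_apply, Matrix.diagonal_apply]
      split_ifs
      · simp
      · simp
  let N : Matrix (Fin p) (Fin q) ℝ[X] :=
    C.map Polynomial.C * A.charmatrix.adjugate * B.map Polynomial.C +
      A.charpoly • D.map Polynomial.C
  refine ⟨N i j, ?_, ?_⟩
  · rw [Matrix.charpoly_natDegree_eq_dim, Fintype.card_fin]
    change ((C.map Polynomial.C * A.charmatrix.adjugate * B.map Polynomial.C) i j +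
      A.charpoly * Polynomial.C (D i j)).natDegree ≤ k
    refine natDegree_add_le_of_degree_le ?_ ?_
    · rw [Matrix.mul_apply]
      refine natDegree_sum_le_of_forall_le _ _ fun l _ => ?_
      refine (natDegree_mul_C_le _ _).trans ?_
      rw [Matrix.mul_apply]
      refine natDegree_sum_le_of_forall_le _ _ fun m _ => ?_
      exact (natDegree_C_mul_le _ _).trans (hadj _ _)
    · refine (natDegree_mul_C_le _ _).trans ?_
      rw [Matrix.charpoly_natDegree_eq_dim, Fintype.card_fin]
  · have hc : algebraMap ℝ[X] (RatFunc ℝ) A.charpoly ≠ 0 :=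
      RatFunc.algebraMap_ne_zero A.charpoly_monic.ne_zero
    rw [eq_div_iff hc]
    have hN : N.map (algebraMap ℝ[X] (RatFunc ℝ)) =
        C.map RatFunc.C * ((RatFunc.X : RatFunc ℝ) • 1 - A.map RatFunc.C).adjugate *
          B.map RatFunc.C + algebraMap ℝ[X] (RatFunc ℝ) A.charpoly • D.map RatFunc.C := by
      have hadj' : A.charmatrix.adjugate.map (algebraMap ℝ[X] (RatFunc ℝ)) =
          ((RatFunc.X : RatFunc ℝ) • 1 - A.map RatFunc.C).adjugate := by
        rw [← charmatrix_map_ratFunc, ← RingHom.mapMatrix_apply, RingHom.map_adjugate,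
          RingHom.mapMatrix_apply]
      rw [← hadj']
      ext i j
      simp only [N, Matrix.mul_apply, Matrix.map_apply, Matrix.add_apply, Matrix.smul_apply,
        smul_eq_mul, map_add, map_mul, map_sum, RatFunc.algebraMap_C]
    have := congrFun (congrFun hN i) j
    rw [Matrix.map_apply] at this
    rw [this, transferMatrix, Matrix.inv_def, det_resolvent_ratFunc, Ring.inverse_eq_inv']
    simp only [Matrix.mul_smul, Matrix.smul_mul, Matrix.add_apply, Matrix.smul_apply, smul_eq_mul]
    field_simp

theorem IsHurwitz.aeval_charpoly_ne_zero {A : Matrix (Fin k) (Fin k) ℝ} (h : IsHurwitz A) {s : ℂ}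
    (hs : 0 ≤ s.re) : aeval s A.charpoly ≠ 0 := by
  have h1 := isHurwitz_iff.1 h s hs
  rw [Matrix.isUnit_iff_isUnit_det, isUnit_iff_ne_zero] at h1
  rw [aeval_def, ← eval_map, ← Matrix.charpoly_map, Matrix.eval_charpoly]
  convert h1
  ext i j
  simp [Matrix.scalar_apply, Matrix.diagonal_apply, Matrix.one_apply]

theorem IsHurwitz.transferMatrix_mem_regularAt {A : Matrix (Fin k) (Fin k) ℝ} (h : IsHurwitz A)
    (B : Matrix (Fin k) (Fin q) ℝ) (C : Matrix (Fin p) (Fin k) ℝ) (D : Matrix (Fin p) (Fin q) ℝ)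
    {s : ℂ} (hs : 0 ≤ s.re) (i : Fin p) (j : Fin q) :
    transferMatrix A B C D i j ∈ regularAt s := by
  obtain ⟨r, -, hr⟩ := exists_transferMatrix_apply_eq_div A B C D i j
  rw [mem_regularAt, hr]
  intro h0
  obtain ⟨u, hu⟩ := RatFunc.denom_div_dvd r A.charpoly
  apply h.aeval_charpoly_ne_zero hs
  rw [hu, map_mul, h0, zero_mul]

theorem IsHurwitz.transferMatrix_mem_RHInf {n : ℕ} {A : Matrix (Fin k) (Fin k) ℝ} (h : IsHurwitz A)
    (B : Matrix (Fin k) (Fin n) ℝ) (C : Matrix (Fin n) (Fin k) ℝ) (D : Matrix (Fin n) (Fin n) ℝ) :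
    transferMatrix A B C D ∈ RHInf n := by
  intro i j
  refine ⟨?_, fun s hs => ?_⟩
  · obtain ⟨r, hd, hr⟩ := exists_transferMatrix_apply_eq_div A B C D i j
    have h0 := A.charpoly_monic.ne_zero
    rw [← RatFunc.num_mul_eq_mul_denom_iff h0] at hr
    by_cases hn : (transferMatrix A B C D i j).num = 0
    · simp [hn]
    · have hr0 : r ≠ 0 := by
        rintro rfl
        rw [zero_mul] at hr
        exact (mul_ne_zero hn h0) hr
      have := congrArg natDegree hr
      rw [natDegree_mul hn h0, natDegree_mul hr0 (RatFunc.denom_ne_zero _)] at this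
      omega
  · by_contra hs'
    exact h.transferMatrix_mem_regularAt B C D (not_lt.1 hs') i j hs

theorem IsHurwitz.evalAt_transferMatrix {n : ℕ} {A : Matrix (Fin k) (Fin k) ℝ} (h : IsHurwitz A)
    (B : Matrix (Fin k) (Fin n) ℝ) (C : Matrix (Fin n) (Fin k) ℝ) (D : Matrix (Fin n) (Fin n) ℝ)
    {s : ℂ} (hs : 0 ≤ s.re) :
    evalAt (transferMatrix A B C D) s =
      C.map (algebraMap ℝ ℂ) * (s • 1 - A.map (algebraMap ℝ ℂ))⁻¹ * B.map (algebraMap ℝ ℂ) +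
        D.map (algebraMap ℝ ℂ) := by
  have hreg : ∀ i j, ((RatFunc.X : RatFunc ℝ) • 1 - A.map RatFunc.C)⁻¹ i j ∈ regularAt s := by
    intro i j
    -- With `B = C = 1` and `D = 0` the transfer matrix is the resolvent itself.
    have := h.transferMatrix_mem_regularAt 1 1 0 hs i j
    simpa [transferMatrix] using this
  rw [Matrix.inv_eq_left_inv (eval_mul_resolvent_eq_one hreg)]
  set Φ := ((RatFunc.X : RatFunc ℝ) • 1 - A.map RatFunc.C)⁻¹ with hΦ
  ext i j
  have h1 : transferMatrix A B C D i j = ((∑ l, (∑ m, ⟨RatFunc.C (C i m), C_mem_regularAt s _⟩ *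
      ⟨Φ m l, hreg m l⟩) * ⟨RatFunc.C (B l j), C_mem_regularAt s _⟩ +
      ⟨RatFunc.C (D i j), C_mem_regularAt s _⟩ : regularAt s) : RatFunc ℝ) := by
    simp [transferMatrix, Matrix.mul_apply, Φ]
  rw [evalAt, Matrix.map_apply, h1]
  change evalRegular s _ = _
  simp only [map_add, map_sum, map_mul, evalRegular_C]
  simp [Matrix.mul_apply, evalRegular]

end Realisation

/-! ### Lyapunov equations via the Cayley transform. -/

section Lyapunov

variable {k q p : ℕ}

/-- Gelfand's formula bounds `‖a ^ N‖` by `r ^ N` eventually, for some `r < 1`. -/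
theorem tendsto_pow_zero_of_spectralRadius_lt_one {E : Type*} [NormedRing E] [NormedAlgebra ℂ E]
    [CompleteSpace E] {a : E} (h : spectralRadius ℂ a < 1) :
    Tendsto (fun N : ℕ => a ^ N) atTop (𝓝 0) := by
  obtain ⟨r, hr1, hr2⟩ := ENNReal.lt_iff_exists_nnreal_btwn.1 h
  have hr2 : r < 1 := by exact_mod_cast hr2
  have hev := (spectrum.pow_nnnorm_pow_one_div_tendsto_nhds_spectralRadius a).eventually_lt_const hr1
  rw [tendsto_zero_iff_norm_tendsto_zero]
  refine squeeze_zero' (Eventually.of_forall fun _ => norm_nonneg _) ?_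
    (tendsto_pow_atTop_nhds_zero_of_lt_one r.2 (by exact_mod_cast hr2))
  filter_upwards [hev, eventually_gt_atTop 0] with N hN hN0
  have hN0' : (0 : ℝ) < N := by exact_mod_cast hN0
  have h1 : (‖a ^ N‖₊ : ENNReal) ≤ (r : ENNReal) ^ N := by
    have := ENNReal.rpow_le_rpow hN.le hN0'.le
    rwa [← ENNReal.rpow_mul, one_div_mul_cancel hN0'.ne', ENNReal.rpow_one,
      ENNReal.rpow_natCast] at this
  have h2 : ‖a ^ N‖₊ ≤ r ^ N := by exact_mod_cast h1
  exact_mod_cast h2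

theorem tendsto_pow_zero_of_spectrum {F : Matrix (Fin k) (Fin k) ℂ}
    (h : ∀ μ ∈ spectrum ℂ F, ‖μ‖ < 1) : Tendsto (fun N : ℕ => F ^ N) atTop (𝓝 0) := by
  rcases isEmpty_or_nonempty (Fin k) with hk | hk
  · exact tendsto_nhds_of_eventually_eq (Eventually.of_forall fun _ => Subsingleton.elim _ _)
  let _ := Matrix.linftyOpNormedRing (n := Fin k) (α := ℂ)
  let _ := Matrix.linftyOpNormedAlgebra (R := ℂ) (n := Fin k) (α := ℂ)
  have hlt : spectralRadius ℂ F < (1 : NNReal) :=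
    spectrum.spectralRadius_lt_of_forall_lt F fun μ hμ => by exact_mod_cast h μ hμ
  exact tendsto_pow_zero_of_spectralRadius_lt_one hlt

/-- The Cayley transform of a square matrix. -/
noncomputable def cayley (A : Matrix (Fin k) (Fin k) ℝ) : Matrix (Fin k) (Fin k) ℝ :=
  (1 + A) * (1 - A)⁻¹

theorem map_smul_one_sub (s : ℝ) (A : Matrix (Fin k) (Fin k) ℝ) :
    (s • 1 - A).map (algebraMap ℝ ℂ) = (s : ℂ) • 1 - A.map (algebraMap ℝ ℂ) := by
  ext i j
  by_cases h : i = j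
  · subst h; simp
  · simp [h]

theorem isUnit_det_of_isUnit_map {A : Matrix (Fin k) (Fin k) ℝ}
    (h : IsUnit (A.map (algebraMap ℝ ℂ))) : IsUnit A.det := by
  rw [Matrix.isUnit_iff_isUnit_det, ← RingHom.mapMatrix_apply, ← RingHom.map_det,
    isUnit_iff_ne_zero] at h
  exact isUnit_iff_ne_zero.2 fun h0 => h (by simp [h0])

theorem IsHurwitz.isUnit_det_one_sub {A : Matrix (Fin k) (Fin k) ℝ} (h : IsHurwitz A) :
    IsUnit (1 - A).det := by
  have h1 := isHurwitz_iff.1 h ((1 : ℝ) : ℂ) (by simp)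
  rw [← map_smul_one_sub, one_smul] at h1
  exact isUnit_det_of_isUnit_map h1

/-- Multiplying `μ - cayley A` by `1 - A` gives `(μ - 1) - (μ + 1) A`. For `‖μ‖ ≥ 1` and `μ ≠ -1`,
the point `(μ - 1)/(μ + 1)` has real part `(|μ|² - 1)/|μ + 1|² ≥ 0`, so it is not an eigenvalue of
`A`. -/
theorem IsHurwitz.norm_lt_one_of_mem_spectrum_cayley {A : Matrix (Fin k) (Fin k) ℝ}
    (h : IsHurwitz A) {μ : ℂ} (hμ : μ ∈ spectrum ℂ ((cayley A).map (algebraMap ℝ ℂ))) :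
    ‖μ‖ < 1 := by
  by_contra! hge
  rw [spectrum.mem_iff, Algebra.algebraMap_eq_smul_one] at hμ
  apply hμ
  set A' := A.map (algebraMap ℝ ℂ) with hA'
  have hunit : IsUnit (μ • (1 - A') - (1 + A')) := by
    have e : μ • (1 - A') - (1 + A') = (μ - 1) • (1 : Matrix (Fin k) (Fin k) ℂ) - (μ + 1) • A' := by
      module
    rw [e]
    by_cases h1 : μ + 1 = 0
    · rw [h1, zero_smul, sub_zero, show μ - 1 = -2 by linear_combination h1]
      exact isUnit_one.smul (Units.mk0 (-2 : ℂ) (by norm_num))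
    · have e2 : (μ - 1) • (1 : Matrix (Fin k) (Fin k) ℂ) - (μ + 1) • A' =
          (Units.mk0 _ h1) • (((μ - 1) / (μ + 1)) • 1 - A') := by
        rw [smul_sub, Units.smul_mk0, Units.smul_mk0, smul_smul, mul_div_cancel₀ _ h1]
      rw [e2]
      refine IsUnit.smul _ (isHurwitz_iff.1 h _ ?_)
      have h2 : 1 ≤ μ.re * μ.re + μ.im * μ.im := by
        rw [← Complex.normSq_apply, Complex.normSq_eq_norm_sq]
        nlinarith
      rw [Complex.div_re]
      have h3 : 0 < Complex.normSq (μ + 1) := Complex.normSq_pos.2 h1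
      rw [← add_div]
      apply div_nonneg _ h3.le
      simp
      nlinarith
  have hc : ((cayley A).map (algebraMap ℝ ℂ)) * (1 - A') = 1 + A' := by
    have : cayley A * (1 - A) = 1 + A := by
      rw [cayley, Matrix.mul_assoc, Matrix.nonsing_inv_mul _ h.isUnit_det_one_sub, Matrix.mul_one]
    have := congrArg (algebraMap ℝ ℂ).mapMatrix this
    simpa only [map_mul, map_add, map_sub, map_one, RingHom.mapMatrix_apply] using this
  have he : (μ • 1 - (cayley A).map (algebraMap ℝ ℂ)) * (1 - A') = μ • (1 - A') - (1 + A') := by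
    rw [Matrix.sub_mul, hc, Matrix.smul_mul, Matrix.one_mul]
  rw [← he] at hunit
  rw [Matrix.isUnit_iff_isUnit_det, Matrix.det_mul] at hunit
  exact (Matrix.isUnit_iff_isUnit_det _).2 (isUnit_of_mul_isUnit_left hunit)

theorem IsHurwitz.tendsto_cayley_pow {A : Matrix (Fin k) (Fin k) ℝ} (h : IsHurwitz A) :
    Tendsto (fun N : ℕ => cayley A ^ N) atTop (𝓝 0) := by
  have h1 := tendsto_pow_zero_of_spectrum fun μ hμ => h.norm_lt_one_of_mem_spectrum_cayley hμ
  refine tendsto_pi_nhds.2 fun i => tendsto_pi_nhds.2 fun j => ?_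
  have h2 := ((continuous_apply_apply i j).tendsto _).comp h1
  have h3 := (Complex.continuous_re.tendsto _).comp h2
  refine h3.congr fun N => ?_
  change (((cayley A).map (algebraMap ℝ ℂ) ^ N) i j).re = _
  rw [← RingHom.mapMatrix_apply, ← map_pow]
  simp

/-- The Lyapunov operator as a Stein operator of the Cayley transform. -/
theorem IsHurwitz.sub_cayley_conj {A : Matrix (Fin k) (Fin k) ℝ} (h : IsHurwitz A)
    (X : Matrix (Fin k) (Fin k) ℝ) :
    X - (cayley A)ᵀ * X * cayley A =
      ((1 - A)⁻¹)ᵀ * (-(2 : ℝ) • (X * A + Aᵀ * X)) * (1 - A)⁻¹ := by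
  have h1 := Matrix.mul_nonsing_inv _ h.isUnit_det_one_sub
  have h2 : ((1 - A)⁻¹)ᵀ * (1 - Aᵀ) = 1 := by
    have := congrArg Matrix.transpose h1
    rwa [Matrix.transpose_mul, Matrix.transpose_sub, Matrix.transpose_one] at this
  have e : X = ((1 - A)⁻¹)ᵀ * ((1 - Aᵀ) * X * (1 - A)) * (1 - A)⁻¹ := by
    calc X = (((1 - A)⁻¹)ᵀ * (1 - Aᵀ)) * X * ((1 - A) * (1 - A)⁻¹) := by
          rw [h1, h2, Matrix.one_mul, Matrix.mul_one]
      _ = _ := by simp only [Matrix.mul_assoc]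
  have e2 : (cayley A)ᵀ * X * cayley A =
      ((1 - A)⁻¹)ᵀ * ((1 + Aᵀ) * X * (1 + A)) * (1 - A)⁻¹ := by
    simp only [cayley, Matrix.transpose_mul, Matrix.transpose_add, Matrix.transpose_one,
      Matrix.mul_assoc]
  conv_lhs => rw [e2]; enter [1]; rw [e]
  rw [← Matrix.sub_mul, ← Matrix.mul_sub]
  congr 2
  rw [neg_smul, two_smul]
  noncomm_ring

theorem IsHurwitz.tendsto_cayley_conj {A : Matrix (Fin k) (Fin k) ℝ} (h : IsHurwitz A)
    (X : Matrix (Fin k) (Fin k) ℝ) :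
    Tendsto (fun N : ℕ => (cayley A ^ N)ᵀ * X * cayley A ^ N) atTop (𝓝 0) := by
  have h1 := h.tendsto_cayley_pow
  have hc : Continuous fun M : Matrix (Fin k) (Fin k) ℝ => Mᵀ * X * M := by fun_prop
  have := (hc.tendsto 0).comp h1
  rwa [Matrix.mul_zero] at this

/-- With `F = cayley A` the hypothesis becomes `X ≥ Fᵀ X F`. Iterating gives `X ≥ (F ^ N)ᵀ X F ^ N →
0`, a discrete substitute for the integral of `exp(tAᵀ) Q exp(tA)`. -/
theorem IsHurwitz.posSemidef_of_lyapunov {A : Matrix (Fin k) (Fin k) ℝ} (h : IsHurwitz A)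
    {X : Matrix (Fin k) (Fin k) ℝ} (hX : X.IsHermitian)
    (hL : (-(X * A + Aᵀ * X)).PosSemidef) : X.PosSemidef := by
  refine .of_dotProduct_mulVec_nonneg hX fun v => ?_
  have hstep : (X - (cayley A)ᵀ * X * cayley A).PosSemidef := by
    rw [h.sub_cayley_conj]
    have := (hL.smul (zero_le_two (α := ℝ))).conjTranspose_mul_mul_same (1 - A)⁻¹
    simpa only [conjTranspose_eq_transpose_of_trivial, smul_neg, neg_smul] using this
  have hN : ∀ N : ℕ, v ⬝ᵥ ((cayley A ^ N)ᵀ * X * cayley A ^ N) *ᵥ v ≤ v ⬝ᵥ X *ᵥ v := by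
    intro N
    induction N with
    | zero => simp
    | succ N ih =>
      refine le_trans ?_ ih
      have h1 := (hstep.conjTranspose_mul_mul_same (cayley A ^ N)).dotProduct_mulVec_nonneg v
      rw [conjTranspose_eq_transpose_of_trivial, star_trivial, Matrix.mul_sub, Matrix.sub_mul,
        Matrix.sub_mulVec, dotProduct_sub, sub_nonneg] at h1
      rw [pow_succ', Matrix.transpose_mul]
      simpa only [Matrix.mul_assoc] using h1
  have hc : Continuous fun M : Matrix (Fin k) (Fin k) ℝ => v ⬝ᵥ M *ᵥ v := by fun_prop
  have hlim := (hc.tendsto 0).comp (h.tendsto_cayley_conj X)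
  have := le_of_tendsto hlim (Eventually.of_forall hN)
  simpa using this

theorem IsHurwitz.eq_zero_of_lyapunov {A : Matrix (Fin k) (Fin k) ℝ} (h : IsHurwitz A)
    {X : Matrix (Fin k) (Fin k) ℝ} (hL : X * A + Aᵀ * X = 0) : X = 0 := by
  have hstep : X = (cayley A)ᵀ * X * cayley A := by
    have := h.sub_cayley_conj X
    rw [hL, smul_zero, Matrix.mul_zero, Matrix.zero_mul] at this
    exact sub_eq_zero.1 this
  have hN : ∀ N : ℕ, (cayley A ^ N)ᵀ * X * cayley A ^ N = X := by
    intro N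
    induction N with
    | zero => simp
    | succ N ih =>
      conv_rhs => rw [← ih, hstep]
      rw [pow_succ', Matrix.transpose_mul]
      simp only [Matrix.mul_assoc]
  have := h.tendsto_cayley_conj X
  simp only [hN] at this
  exact tendsto_nhds_unique tendsto_const_nhds this

/-- The Lyapunov operator is injective, hence surjective in finite dimension. The transpose of a
solution is again a solution, so uniqueness makes it symmetric. -/
theorem IsHurwitz.exists_lyapunov {A : Matrix (Fin k) (Fin k) ℝ} (h : IsHurwitz A)
    {Q : Matrix (Fin k) (Fin k) ℝ} (hQ : Q.IsHermitian) :
    ∃ X : Matrix (Fin k) (Fin k) ℝ, X.IsHermitian ∧ X * A + Aᵀ * X = Q := by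
  let L : Matrix (Fin k) (Fin k) ℝ →ₗ[ℝ] Matrix (Fin k) (Fin k) ℝ :=
    { toFun := fun X => X * A + Aᵀ * X
      map_add' := fun X Y => by rw [Matrix.add_mul, Matrix.mul_add]; abel
      map_smul' := fun c X => by simp [smul_add] }
  have hinj : Function.Injective L :=
    (injective_iff_map_eq_zero L).2 fun X hX => h.eq_zero_of_lyapunov hX
  obtain ⟨X, hX⟩ := (LinearMap.injective_iff_surjective.1 hinj) Q
  have hX : X * A + Aᵀ * X = Q := hX
  refine ⟨X, ?_, hX⟩
  have h2 : Xᴴ * A + Aᵀ * Xᴴ = Q := by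
    have := congrArg conjTranspose hX
    rw [hQ.eq] at this
    rw [← this]
    simp [conjTranspose_eq_transpose_of_trivial, add_comm]
  exact hinj (h2.trans hX.symm)

/-- If `X v = 0`, the semidefinite form `-(XA + AᵀX)` vanishes at `v`, which forces `X A v = 0`. So
the kernel of `X` is `A`-invariant and lies in that of `C`; observability makes it zero. -/
theorem IsHurwitz.posDef_of_lyapunov {A : Matrix (Fin k) (Fin k) ℝ} (h : IsHurwitz A)
    {C : Matrix (Fin p) (Fin k) ℝ} (hAC : IsControllable Aᵀ Cᵀ)
    {X : Matrix (Fin k) (Fin k) ℝ} (hX : X.IsHermitian)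
    (hL : (-(X * A + Aᵀ * X)).PosSemidef) (hC : ∀ v, X *ᵥ v = 0 → C *ᵥ v = 0) : X.PosDef := by
  have hpsd := h.posSemidef_of_lyapunov hX hL
  have hXT : Xᵀ = X := by rw [← conjTranspose_eq_transpose_of_trivial]; exact hX
  have hinv : ∀ v, X *ᵥ v = 0 → X *ᵥ (A *ᵥ v) = 0 := by
    intro v hv
    have hv' : v ᵥ* X = 0 := by rw [← hXT, vecMul_transpose, hv]
    have h1 : (-(X * A + Aᵀ * X)) *ᵥ v = 0 := by
      rw [← hL.dotProduct_mulVec_zero_iff, star_trivial, neg_mulVec, dotProduct_neg, add_mulVec,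
        dotProduct_add, ← mulVec_mulVec, ← mulVec_mulVec, hv, mulVec_zero, dotProduct_mulVec v X,
        hv']
      simp
    rw [neg_mulVec, add_mulVec, ← mulVec_mulVec, ← mulVec_mulVec, hv, mulVec_zero, add_zero,
      neg_eq_zero] at h1
    exact h1
  have hker : ∀ v, X *ᵥ v = 0 → v = 0 := by
    intro v hv
    -- The orthogonal complement of the kernel of `X`: it is `Aᵀ`-invariant and contains the rows of
    -- `C`.
    let V : Submodule ℝ (Fin k → ℝ) :=
      { carrier := {w | ∀ v, X *ᵥ v = 0 → w ⬝ᵥ v = 0}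
        zero_mem' := by intro v _; simp
        add_mem' := by intro a b ha hb v hv; rw [add_dotProduct, ha v hv, hb v hv, add_zero]
        smul_mem' := by intro c a ha v hv; rw [smul_dotProduct, ha v hv, smul_zero] }
    have hV : V = ⊤ := hAC V (fun j v hv => congrFun (hC v hv) j) (fun w hw v hv => by
      rw [mulVec_transpose, ← dotProduct_mulVec]
      exact hw _ (hinv v hv))
    have : v ∈ V := hV ▸ Submodule.mem_top
    exact dotProduct_self_eq_zero.1 (this v hv)
  refine .of_dotProduct_mulVec_pos hX fun v hv => ?_
  refine lt_of_le_of_ne (hpsd.dotProduct_mulVec_nonneg v) fun h0 => hv (hker v ?_)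
  exact (hpsd.dotProduct_mulVec_zero_iff v).1 h0.symm

theorem IsHurwitz.exists_gramian {A : Matrix (Fin k) (Fin k) ℝ} (h : IsHurwitz A)
    {B : Matrix (Fin k) (Fin q) ℝ} (hAB : IsControllable A B) :
    ∃ P : Matrix (Fin k) (Fin k) ℝ, P.PosDef ∧ A * P + P * Aᵀ = -(B * Bᵀ) := by
  have hpsd : (B * Bᵀ).PosSemidef := by
    simpa [conjTranspose_eq_transpose_of_trivial] using posSemidef_self_mul_conjTranspose B
  obtain ⟨P, hP, hL⟩ := h.transpose.exists_lyapunov (Q := -(B * Bᵀ)) hpsd.isHermitian.neg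
  rw [transpose_transpose] at hL
  refine ⟨P, ?_, by rw [add_comm, hL]⟩
  refine h.transpose.posDef_of_lyapunov (C := Bᵀ) (by simpa using hAB) hP
    (by rw [transpose_transpose, hL, neg_neg]; exact hpsd) ?_
  intro v hv
  have hPT : Pᵀ = P := by rw [← conjTranspose_eq_transpose_of_trivial]; exact hP
  have hv' : v ᵥ* P = 0 := by rw [← hPT, vecMul_transpose, hv]
  have h1 := congrArg (fun M => v ⬝ᵥ M *ᵥ v) hL
  simp only [add_mulVec, neg_mulVec, dotProduct_neg, ← mulVec_mulVec, hv,
    mulVec_zero, dotProduct_mulVec v P, hv', zero_dotProduct, add_zero] at h1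
  rw [dotProduct_mulVec, ← mulVec_transpose] at h1
  exact dotProduct_self_eq_zero.1 (neg_eq_zero.1 h1.symm)

end Lyapunov

/-! ### Closed cones and Farkas' lemma. -/

/-- Compactness of the unit sphere in `S` gives `m ‖x‖ ≤ ‖T x‖` on `S` with `m > 0`. Preimages of a
convergent sequence are then bounded, so a subsequence converges. -/
theorem isClosed_image_cone {E F : Type*} [NormedAddCommGroup E] [NormedSpace ℝ E]
    [FiniteDimensional ℝ E] [NormedAddCommGroup F] [NormedSpace ℝ F] (T : E →L[ℝ] F) {S : Set E}
    (hS : IsClosed S) (hcone : ∀ c : ℝ, 0 ≤ c → ∀ x ∈ S, c • x ∈ S)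
    (h0 : ∀ x ∈ S, T x = 0 → x = 0) : IsClosed (T '' S) := by
  have : ProperSpace E := FiniteDimensional.proper ℝ E
  obtain ⟨m, hm, hmb⟩ : ∃ m : ℝ, 0 < m ∧ ∀ x ∈ S, m * ‖x‖ ≤ ‖T x‖ := by
    have hK : IsCompact (S ∩ Metric.sphere (0 : E) 1) := (isCompact_sphere 0 1).inter_left hS
    have hscale : ∀ m : ℝ, (∀ x ∈ S ∩ Metric.sphere (0 : E) 1, m ≤ ‖T x‖) →
        ∀ x ∈ S, m * ‖x‖ ≤ ‖T x‖ := by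
      intro m hm x hx
      by_cases hx0 : x = 0
      · simp [hx0]
      have hn : 0 < ‖x‖ := norm_pos_iff.2 hx0
      have := hm (‖x‖⁻¹ • x) ⟨hcone _ (inv_nonneg.2 hn.le) x hx, by
        simp [norm_smul, hn.ne']⟩
      rw [map_smul, norm_smul, norm_inv, norm_norm, inv_mul_eq_div, le_div_iff₀ hn] at this
      exact this
    rcases (S ∩ Metric.sphere (0 : E) 1).eq_empty_or_nonempty with he | hne
    · exact ⟨1, one_pos, hscale 1 (by simp [he])⟩
    · obtain ⟨x, hx, hmin⟩ := hK.exists_isMinOn hne (T.continuous.norm.continuousOn)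
      refine ⟨‖T x‖, ?_, hscale _ fun y hy => hmin hy⟩
      refine norm_pos_iff.2 fun hT => ?_
      have := hx.2
      rw [h0 x hx.1 hT] at this
      simp at this
  refine isClosed_of_closure_subset fun y hy => ?_
  obtain ⟨u, hu, hlim⟩ := mem_closure_iff_seq_limit.1 hy
  choose x hxS hx using hu
  obtain ⟨R, hR⟩ := (Metric.isBounded_range_of_tendsto u hlim).exists_norm_le
  have hb : ∀ n, x n ∈ Metric.closedBall (0 : E) (R / m) := fun n => by
    rw [mem_closedBall_zero_iff, le_div_iff₀ hm, mul_comm]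
    exact (hmb _ (hxS n)).trans (by rw [hx]; exact hR _ ⟨n, rfl⟩)
  obtain ⟨a, -, φ, hφ, ha⟩ := (isCompact_closedBall (0 : E) (R / m)).tendsto_subseq hb
  refine ⟨a, hS.mem_of_tendsto ha (Eventually.of_forall fun n => hxS _), ?_⟩
  refine tendsto_nhds_unique ((T.continuous.tendsto a).comp ha) ?_
  refine (hlim.comp hφ.tendsto_atTop).congr fun n => ?_
  simp [hx]

/-- **Farkas' lemma** for a linear map that is injective at the apex of a closed cone. -/
theorem exists_mem_or_exists_separating {E F : Type*}
    [AddCommGroup E] [Module ℝ E] [TopologicalSpace E] [IsTopologicalAddGroup E] [T2Space E]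
    [ContinuousSMul ℝ E] [FiniteDimensional ℝ E]
    [AddCommGroup F] [Module ℝ F] [TopologicalSpace F] [IsTopologicalAddGroup F] [T2Space F]
    [ContinuousSMul ℝ F] [FiniteDimensional ℝ F] (T : E →ₗ[ℝ] F) {S : PointedCone ℝ E}
    (hS : IsClosed (S : Set E)) (h0 : ∀ x ∈ S, T x = 0 → x = 0) (y : F) :
    (∃ x ∈ S, T x = y) ∨ ∃ f : F →ₗ[ℝ] ℝ, (∀ x ∈ S, 0 ≤ f (T x)) ∧ f y < 0 := by
  -- Only topologies are given on `E` and `F`; Euclidean coordinates supply the norms used below.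
  let e : E ≃L[ℝ] _ := toEuclidean
  let e' : F ≃L[ℝ] _ := toEuclidean
  let S' := S.map e.toLinearEquiv.toLinearMap
  have hmemS' : ∀ x, x ∈ S' ↔ e.symm x ∈ S := fun x =>
    ⟨by rintro ⟨z, hz, rfl⟩; simpa using hz, fun h => ⟨_, h, by simp⟩⟩
  let T' := e'.toLinearEquiv.toLinearMap ∘ₗ T ∘ₗ e.symm.toLinearEquiv.toLinearMap
  have hT' : ∀ x, T' x = e' (T (e.symm x)) := fun x => rfl
  have hclosed : IsClosed (T' '' S') := by
    refine isClosed_image_cone T'.toContinuousLinearMap ?_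
      (fun c hc x hx => S'.smul_mem hc hx) fun x hx hx0 => ?_
    · have : (S' : Set _) = e.symm ⁻¹' S := Set.ext hmemS'
      rw [this]
      exact hS.preimage e.symm.continuous
    · have h1 : e' (T (e.symm x)) = 0 := hx0
      have h2 := h0 _ ((hmemS' x).1 hx) (by simpa using h1)
      simpa using h2
  let K : ProperCone ℝ _ := ⟨S'.map T', hclosed⟩
  by_cases hmem : e' y ∈ K
  · obtain ⟨x, hx, hxy⟩ := hmem
    refine .inl ⟨e.symm x, (hmemS' x).1 hx, e'.injective ?_⟩
    exact hxy
  · obtain ⟨f, hf, hneg⟩ := ProperCone.hyperplane_separation_point K hmem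
    refine .inr ⟨f.toLinearMap ∘ₗ e'.toLinearEquiv.toLinearMap, fun x hx => ?_, hneg⟩
    exact hf _ ⟨e x, (hmemS' _).2 (by simpa using hx), by simp [T']⟩

theorem exists_trace_eq {m n : Type*} [Fintype m] [Fintype n] [DecidableEq m] [DecidableEq n]
    (g : Matrix m n ℝ →ₗ[ℝ] ℝ) : ∃ W : Matrix n m ℝ, ∀ M, g M = (W * M).trace := by
  refine ⟨Matrix.of fun j i => g (Matrix.single i j 1), fun M => ?_⟩
  conv_lhs => rw [Matrix.matrix_eq_sum_single M]
  simp only [map_sum, Matrix.trace, Matrix.diag_apply, Matrix.mul_apply, Matrix.of_apply]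
  rw [Finset.sum_comm]
  refine Finset.sum_congr rfl fun j _ => Finset.sum_congr rfl fun i _ => ?_
  rw [show Matrix.single i j (M i j) = M i j • Matrix.single i j (1 : ℝ) by simp, map_smul,
    smul_eq_mul, mul_comm]

theorem conjTranspose_map_algebraMap {m n : Type*} (L : Matrix m n ℝ) :
    (L.map (algebraMap ℝ ℂ))ᴴ = Lᵀ.map (algebraMap ℝ ℂ) := by
  ext i j; simp

theorem isClosed_isHermitian (n : Type*) :
    IsClosed {M : Matrix n n ℝ | M.IsHermitian} :=
  isClosed_eq (continuous_id.matrix_conjTranspose) continuous_id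

theorem isClosed_posSemidef {n 𝕜 : Type*} [Fintype n] [RCLike 𝕜] :
    IsClosed {M : Matrix n n 𝕜 | M.PosSemidef} := by
  have : {M : Matrix n n 𝕜 | M.PosSemidef} =
      {M : Matrix n n 𝕜 | Mᴴ = M} ∩ ⋂ x : n → 𝕜, {M | 0 ≤ star x ⬝ᵥ M *ᵥ x} := by
    ext M
    simp only [Set.mem_ofPred_eq, Set.mem_inter_iff, Set.mem_iInter]
    exact posSemidef_iff_dotProduct_mulVec
  rw [this]
  refine (isClosed_eq (continuous_id.matrix_conjTranspose) continuous_id).inter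
    (isClosed_iInter fun x => ?_)
  exact isClosed_le continuous_const (by fun_prop)

/-! ### The positive real lemma. -/

section PositiveReal

variable {k n : ℕ}

/-- The real part of the quadratic form of `C (jω - A)⁻¹ B` is nonnegative at all frequencies. -/
def IsPositiveReal (A : Matrix (Fin k) (Fin k) ℝ) (B : Matrix (Fin k) (Fin n) ℝ)
    (C : Matrix (Fin n) (Fin k) ℝ) : Prop :=
  ∀ (ω : ℝ) (u : Fin n → ℂ), 0 ≤ (star u ⬝ᵥ (C.map (algebraMap ℝ ℂ) *
    ((Complex.I * ω) • 1 - A.map (algebraMap ℝ ℂ))⁻¹ * B.map (algebraMap ℝ ℂ)) *ᵥ u).re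

open scoped MatrixOrder in
theorem exists_eq_mul_transpose {W : Matrix (Fin k) (Fin k) ℝ} (hW : W.PosSemidef) :
    ∃ V : Matrix (Fin k) (Fin k) ℝ, W = V * Vᵀ := by
  have h : CFC.sqrt W * CFC.sqrt W = W :=
    CFC.sqrt_mul_sqrt_self W (Matrix.nonneg_iff_posSemidef.2 hW)
  have h2 : (CFC.sqrt W)ᵀ = CFC.sqrt W := by
    rw [← conjTranspose_eq_transpose_of_trivial]
    exact (Matrix.nonneg_iff_posSemidef.1 (CFC.sqrt_nonneg W)).isHermitian
  exact ⟨CFC.sqrt W, by rw [h2, h]⟩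

/-- A matrix that is skew with respect to a positive definite `W` is diagonalisable, with
imaginary eigenvalues and eigenvectors orthonormal for `W`. -/
theorem exists_imaginary_diagonalisation {M W : Matrix (Fin k) (Fin k) ℝ} (hW : W.PosDef)
    (h : M * W + W * Mᵀ = 0) :
    ∃ (Q : Matrix (Fin k) (Fin k) ℂ) (ω : Fin k → ℝ), Q * Qᴴ = W.map (algebraMap ℝ ℂ) ∧
      ∀ i, M.map (algebraMap ℝ ℂ) *ᵥ Q.col i = (Complex.I * ω i) • Q.col i := by
  obtain ⟨V, rfl⟩ := exists_eq_mul_transpose hW.posSemidef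
  have hV : IsUnit V.det := by
    have := (Matrix.isUnit_iff_isUnit_det _).1 hW.isUnit
    rw [Matrix.det_mul] at this
    exact isUnit_of_mul_isUnit_left this
  have hV1 := Matrix.nonsing_inv_mul _ hV
  have hV2 := Matrix.mul_nonsing_inv _ hV
  -- In coordinates where `W` becomes the identity, `M` is skew-symmetric, so `I • N` is Hermitian
  -- and the spectral theorem applies.
  set N := V⁻¹ * M * V with hN
  have hskew : Nᵀ = -N := by
    rw [eq_neg_iff_add_eq_zero, add_comm]
    have h3 : (V⁻¹)ᵀ = (Vᵀ)⁻¹ := Matrix.transpose_nonsing_inv V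
    have hVT : IsUnit Vᵀ.det := by rwa [Matrix.det_transpose]
    calc N + Nᵀ = V⁻¹ * (M * (V * Vᵀ) + V * Vᵀ * Mᵀ) * (Vᵀ)⁻¹ := by
          rw [Matrix.mul_add, Matrix.add_mul]
          congr 1
          · simp only [hN, Matrix.mul_assoc]
            rw [Matrix.mul_nonsing_inv _ hVT, Matrix.mul_one]
          · simp only [hN, Matrix.transpose_mul, h3, Matrix.mul_assoc]
            rw [← Matrix.mul_assoc V⁻¹ V, hV1, Matrix.one_mul]
      _ = 0 := by rw [h, Matrix.mul_zero, Matrix.zero_mul]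
  have hH : (Complex.I • N.map (algebraMap ℝ ℂ)).IsHermitian := by
    rw [Matrix.IsHermitian, conjTranspose_smul, conjTranspose_map_algebraMap, hskew]
    ext i j; simp
  let U : Matrix (Fin k) (Fin k) ℂ := hH.eigenvectorUnitary
  have hU : U * Uᴴ = 1 := Unitary.coe_mul_star_self hH.eigenvectorUnitary
  refine ⟨V.map (algebraMap ℝ ℂ) * U, fun i => -hH.eigenvalues i, ?_, fun i => ?_⟩
  · rw [conjTranspose_mul, Matrix.mul_assoc, ← Matrix.mul_assoc U, hU, Matrix.one_mul,
      conjTranspose_map_algebraMap, ← Matrix.map_mul]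
  · have h1 := hH.mulVec_eigenvectorBasis i
    have hcol : (V.map (algebraMap ℝ ℂ) * U).col i = V.map (algebraMap ℝ ℂ) *ᵥ U.col i := rfl
    have hUc : U.col i = (hH.eigenvectorBasis i : Fin k → ℂ) := by
      ext j; simp [U, Matrix.IsHermitian.eigenvectorUnitary_apply]
    have hMV : M.map (algebraMap ℝ ℂ) * V.map (algebraMap ℝ ℂ) =
        V.map (algebraMap ℝ ℂ) * N.map (algebraMap ℝ ℂ) := by
      rw [← Matrix.map_mul, ← Matrix.map_mul, hN, ← Matrix.mul_assoc, ← Matrix.mul_assoc, hV2,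
        Matrix.one_mul]
    have hNU : N.map (algebraMap ℝ ℂ) *ᵥ U.col i =
        (Complex.I * ((-hH.eigenvalues i : ℝ) : ℂ)) • U.col i := by
      rw [← hUc] at h1
      have h2 := congrArg (fun v => -Complex.I • v) h1
      simp only [Matrix.smul_mulVec, smul_smul, neg_mul, Complex.I_mul_I, neg_neg, one_smul] at h2
      rw [h2]
      ext j
      simp [mul_assoc]
    rw [hcol, Matrix.mulVec_mulVec, hMV, ← Matrix.mulVec_mulVec, hNU, Matrix.mulVec_smul]

/-- The state feedback `K = Z W⁻¹` puts all eigenvalues of `A + B K` on the imaginary axis, where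
positive realness can be tested on each eigenvector. -/
theorem IsPositiveReal.trace_nonneg_of_posDef {A : Matrix (Fin k) (Fin k) ℝ}
    {B : Matrix (Fin k) (Fin n) ℝ} {C : Matrix (Fin n) (Fin k) ℝ} (hG : IsPositiveReal A B C)
    (hA : IsHurwitz A) {W : Matrix (Fin k) (Fin k) ℝ} {Z : Matrix (Fin n) (Fin k) ℝ}
    (hW : W.PosDef) (h : A * W + W * Aᵀ + (B * Z + Zᵀ * Bᵀ) = 0) : 0 ≤ (Z * Cᵀ).trace := by
  have hWT : Wᵀ = W := by rw [← conjTranspose_eq_transpose_of_trivial]; exact hW.isHermitian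
  have hWu := (Matrix.isUnit_iff_isUnit_det _).1 hW.isUnit
  set K := Z * W⁻¹ with hK
  have hKW : K * W = Z := by rw [hK, Matrix.mul_assoc, Matrix.nonsing_inv_mul _ hWu, Matrix.mul_one]
  obtain ⟨Q, ω, hQ, hω⟩ := exists_imaginary_diagonalisation (M := A + B * K) hW (by
    rw [← h, ← hKW]
    simp only [Matrix.transpose_add, Matrix.transpose_mul, hWT, Matrix.add_mul, Matrix.mul_add,
      Matrix.mul_assoc]
    abel)
  set a := A.map (algebraMap ℝ ℂ) with ha
  set b := B.map (algebraMap ℝ ℂ) with hb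
  set c := C.map (algebraMap ℝ ℂ) with hc
  set κ := K.map (algebraMap ℝ ℂ) with hκ
  have htr : (((Z * Cᵀ).trace : ℝ) : ℂ) = ∑ i, star (c *ᵥ Q.col i) ⬝ᵥ (κ *ᵥ Q.col i) := by
    have h1 : (((Z * Cᵀ).trace : ℝ) : ℂ) = ((Z * Cᵀ).map (algebraMap ℝ ℂ)).trace := by
      simp [Matrix.trace]
    have h2 : (Z * Cᵀ).map (algebraMap ℝ ℂ) = κ * Q * (c * Q)ᴴ := by
      rw [← hKW, Matrix.map_mul, Matrix.map_mul, ← hQ, conjTranspose_mul]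
      rw [← conjTranspose_map_algebraMap, ← hc]
      simp only [Matrix.mul_assoc, hκ]
    rw [h1, h2, Matrix.trace_mul_comm]
    rfl
  have hterm : ∀ i, 0 ≤ (star (c *ᵥ Q.col i) ⬝ᵥ (κ *ᵥ Q.col i)).re := by
    intro i
    have hu := isHurwitz_iff.1 hA (Complex.I * ω i) (by simp)
    rw [Matrix.isUnit_iff_isUnit_det] at hu
    have h1 : ((Complex.I * ω i) • 1 - a) *ᵥ Q.col i = b *ᵥ (κ *ᵥ Q.col i) := by
      rw [Matrix.sub_mulVec, Matrix.smul_mulVec, Matrix.one_mulVec, ← hω i, Matrix.mulVec_mulVec,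
        ← Matrix.map_mul, ← Matrix.sub_mulVec]
      congr 1
      ext i j; simp [ha]
    have h2 : c *ᵥ Q.col i = (c * ((Complex.I * ω i) • 1 - a)⁻¹ * b) *ᵥ (κ *ᵥ Q.col i) := by
      rw [← Matrix.mulVec_mulVec _ _ b, ← h1, Matrix.mulVec_mulVec, Matrix.mul_assoc,
        Matrix.nonsing_inv_mul _ hu, Matrix.mul_one]
    have h3 := hG (ω i) (κ *ᵥ Q.col i)
    rw [← ha, ← hb, ← hc, ← h2] at h3
    rw [show star (c *ᵥ Q.col i) ⬝ᵥ (κ *ᵥ Q.col i) = star (star (κ *ᵥ Q.col i) ⬝ᵥ (c *ᵥ Q.col i)) by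
      rw [Matrix.star_dotProduct]]
    exact h3
  have := congrArg Complex.re htr
  rw [Complex.ofReal_re, Complex.re_sum] at this
  rw [this]
  exact Finset.sum_nonneg fun i _ => hterm i

/-- Replace `W` by `W + ε P`, with `P` the Gramian, and `Z` by `Z + (ε/2) Bᵀ`. Since `A P + P Aᵀ =
-B Bᵀ`, the linear constraint survives; then let `ε → 0`. -/
theorem IsPositiveReal.trace_nonneg {A : Matrix (Fin k) (Fin k) ℝ}
    {B : Matrix (Fin k) (Fin n) ℝ} {C : Matrix (Fin n) (Fin k) ℝ} (hG : IsPositiveReal A B C)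
    (hA : IsHurwitz A) (hAB : IsControllable A B) {W : Matrix (Fin k) (Fin k) ℝ}
    {Z : Matrix (Fin n) (Fin k) ℝ}
    (hW : W.PosSemidef) (h : A * W + W * Aᵀ + (B * Z + Zᵀ * Bᵀ) = 0) : 0 ≤ (Z * Cᵀ).trace := by
  obtain ⟨P, hP, hL⟩ := hA.exists_gramian hAB
  have hε : ∀ ε : ℝ, 0 < ε → 0 ≤ ((Z + ε • ((2⁻¹ : ℝ) • Bᵀ)) * Cᵀ).trace := by
    intro ε hε
    refine hG.trace_nonneg_of_posDef hA (W := W + ε • P) (Matrix.PosDef.posSemidef_add hW (hP.smul hε)) ?_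
    have h1 : A * (W + ε • P) + (W + ε • P) * Aᵀ + (B * (Z + ε • ((2⁻¹ : ℝ) • Bᵀ)) +
        (Z + ε • ((2⁻¹ : ℝ) • Bᵀ))ᵀ * Bᵀ) =
        (A * W + W * Aᵀ + (B * Z + Zᵀ * Bᵀ)) + ε • ((A * P + P * Aᵀ) + B * Bᵀ) := by
      simp only [Matrix.mul_add, Matrix.add_mul, Matrix.transpose_add, Matrix.transpose_smul,
        Matrix.transpose_transpose, Matrix.mul_smul, Matrix.smul_mul]
      module
    rw [h1, h, hL]
    simp
  have hcont : Continuous fun ε : ℝ => ((Z + ε • ((2⁻¹ : ℝ) • Bᵀ)) * Cᵀ).trace := by fun_prop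
  have hlim : Tendsto (fun ε : ℝ => ((Z + ε • ((2⁻¹ : ℝ) • Bᵀ)) * Cᵀ).trace) (𝓝[>] 0)
      (𝓝 (Z * Cᵀ).trace) := by
    have := (hcont.tendsto 0).mono_left (nhdsWithin_le_nhds (s := Set.Ioi 0))
    simpa only [zero_smul, add_zero] using this
  exact ge_of_tendsto hlim (eventually_mem_nhdsWithin.mono fun ε h => hε ε h)

/-- The linear map of the Kalman–Yakubovich–Popov matrix inequality. -/
def kypMap (A : Matrix (Fin k) (Fin k) ℝ) (B : Matrix (Fin k) (Fin n) ℝ) :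
    Matrix (Fin k) (Fin k) ℝ × Matrix (Fin k) (Fin k) ℝ →ₗ[ℝ]
      Matrix (Fin k) (Fin k) ℝ × Matrix (Fin k) (Fin n) ℝ where
  toFun x := (x.1 * A + Aᵀ * x.1 + x.2, x.1 * B)
  map_add' x y := by
    ext1
    · simp only [Prod.fst_add, Prod.snd_add, Matrix.add_mul, Matrix.mul_add]; abel
    · simp [Matrix.add_mul]
  map_smul' c x := by
    ext1
    · simp [smul_add]
    · simp

theorem kypMap_apply (A : Matrix (Fin k) (Fin k) ℝ) (B : Matrix (Fin k) (Fin n) ℝ)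
    (X S : Matrix (Fin k) (Fin k) ℝ) :
    kypMap A B (X, S) = (X * A + Aᵀ * X + S, X * B) := rfl

/-- Pairs of a symmetric and a positive semidefinite matrix. -/
def symPosCone (k : ℕ) : PointedCone ℝ (Matrix (Fin k) (Fin k) ℝ × Matrix (Fin k) (Fin k) ℝ) where
  carrier := {x | x.1.IsHermitian ∧ x.2.PosSemidef}
  zero_mem' := ⟨isHermitian_zero, .zero⟩
  add_mem' hx hy := ⟨hx.1.add hy.1, hx.2.add hy.2⟩
  smul_mem' c _ hx := ⟨hx.1.smul (k := (c : ℝ)) (.all _), hx.2.smul c.2⟩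

theorem isClosed_symPosCone (k : ℕ) :
    IsClosed (symPosCone k : Set (Matrix (Fin k) (Fin k) ℝ × Matrix (Fin k) (Fin k) ℝ)) :=
  ((isClosed_isHermitian (Fin k)).preimage continuous_fst).inter
    (isClosed_posSemidef.preimage continuous_snd)

/-- This is the apex condition of Farkas' lemma. If `X v = 0` then `vᵀ S v = 0`, so `S v = 0` and `X
A v = 0`; the kernel of `X` is thus invariant and contains the columns of `B`. -/
theorem eq_zero_of_kypMap_eq_zero {A : Matrix (Fin k) (Fin k) ℝ} {B : Matrix (Fin k) (Fin n) ℝ}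
    (hAB : IsControllable A B) {X S : Matrix (Fin k) (Fin k) ℝ} (hX : X.IsHermitian)
    (hS : S.PosSemidef) (h1 : X * A + Aᵀ * X + S = 0) (h2 : X * B = 0) : X = 0 ∧ S = 0 := by
  have hXT : Xᵀ = X := by rw [← conjTranspose_eq_transpose_of_trivial]; exact hX
  let V : Submodule ℝ (Fin k → ℝ) := LinearMap.ker X.mulVecLin
  have hV : V = ⊤ := by
    refine hAB V (fun j => ?_) fun v hv => ?_
    · have : X *ᵥ B.col j = (X * B).col j := rfl
      rw [LinearMap.mem_ker, mulVecLin_apply, this, h2]; rfl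
    · rw [LinearMap.mem_ker, mulVecLin_apply] at hv ⊢
      have hv' : v ᵥ* X = 0 := by rw [← hXT, vecMul_transpose, hv]
      have h3 := congrArg (fun M => M *ᵥ v) h1
      simp only [add_mulVec, ← mulVec_mulVec, hv, mulVec_zero, add_zero, zero_mulVec] at h3
      have h4 := congrArg (fun w => v ⬝ᵥ w) h3
      simp only [dotProduct_add, dotProduct_mulVec v X, hv', zero_dotProduct, zero_add,
        dotProduct_zero] at h4
      have h5 := (hS.dotProduct_mulVec_zero_iff v).1 h4
      rwa [h5, add_zero] at h3
  have hX0 : X = 0 := by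
    ext i j
    have : Pi.single j 1 ∈ V := hV ▸ Submodule.mem_top
    rw [LinearMap.mem_ker, mulVecLin_apply, mulVec_single_one] at this
    exact congrFun this i
  refine ⟨hX0, ?_⟩
  simpa [hX0] using h1

/-- Testing with `X = H + Hᵀ` shows that its Frobenius norm vanishes. -/
theorem add_transpose_eq_zero_of_trace {H : Matrix (Fin k) (Fin k) ℝ}
    (h : ∀ X : Matrix (Fin k) (Fin k) ℝ, X.IsHermitian → (X * H).trace = 0) : H + Hᵀ = 0 := by
  have h1 : (H + Hᵀ).IsHermitian := by
    rw [← conjTranspose_eq_transpose_of_trivial]; exact isHermitian_add_transpose_self H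
  have h2 := h _ h1
  have h3 : ((H + Hᵀ) * Hᵀ).trace = 0 := by
    rw [← h2, ← Matrix.trace_transpose, Matrix.transpose_mul, Matrix.transpose_transpose,
      Matrix.trace_mul_comm]
    simp [add_comm]
  rw [← trace_conjTranspose_mul_self_eq_zero_iff, h1.eq, Matrix.mul_add, Matrix.trace_add, h2, h3,
    add_zero]

theorem IsPositiveReal.exists_kyp {A : Matrix (Fin k) (Fin k) ℝ}
    {B : Matrix (Fin k) (Fin n) ℝ} {C : Matrix (Fin n) (Fin k) ℝ} (hG : IsPositiveReal A B C)
    (hA : IsHurwitz A) (hAB : IsControllable A B) :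
    ∃ X : Matrix (Fin k) (Fin k) ℝ, X.IsHermitian ∧ (-(X * A + Aᵀ * X)).PosSemidef ∧
      X * B = Cᵀ := by
  have hker : ∀ x ∈ symPosCone k, kypMap A B x = 0 → x = 0 := by
    rintro ⟨X, S⟩ ⟨hX, hS⟩ h0
    rw [kypMap_apply, Prod.mk_eq_zero] at h0
    exact Prod.mk_eq_zero.2 (eq_zero_of_kypMap_eq_zero hAB hX hS h0.1 h0.2)
  rcases exists_mem_or_exists_separating (kypMap A B) (isClosed_symPosCone k) hker (0, Cᵀ) with
    ⟨⟨X, S⟩, ⟨hX, hS⟩, h0⟩ | ⟨f, hf, hneg⟩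
  · rw [kypMap_apply, Prod.mk.injEq] at h0
    refine ⟨X, hX, ?_, h0.2⟩
    rwa [← eq_neg_of_add_eq_zero_right h0.1]
  exfalso
  have hf' : ∀ X S : Matrix (Fin k) (Fin k) ℝ, X.IsHermitian → S.PosSemidef →
      0 ≤ f (X * A + Aᵀ * X + S, X * B) := fun X S hX hS => hf (X, S) ⟨hX, hS⟩
  obtain ⟨W, hW⟩ := exists_trace_eq (f ∘ₗ LinearMap.inl ℝ _ _)
  obtain ⟨Z, hZ⟩ := exists_trace_eq (f ∘ₗ LinearMap.inr ℝ _ _)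
  have hfWZ : ∀ M N, f (M, N) = (W * M).trace + (Z * N).trace := fun M N => by
    rw [← hW, ← hZ]
    simp [← map_add]
  rw [hfWZ, Matrix.mul_zero, Matrix.trace_zero, zero_add] at hneg
  simp only [hfWZ] at hf'
  -- Symmetric test matrices see only the symmetric part of `W`. Using twice that part accounts for
  -- the factors `2` and `2⁻¹` below.
  have hsym : (W + Wᵀ).IsHermitian := by
    rw [← conjTranspose_eq_transpose_of_trivial]; exact isHermitian_add_transpose_self W
  have htwo : ∀ M : Matrix (Fin k) (Fin k) ℝ, M.IsHermitian →
      ((W + Wᵀ) * M).trace = 2 * (W * M).trace := fun M hM => by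
    have hMT : Mᵀ = M := by rw [← conjTranspose_eq_transpose_of_trivial]; exact hM
    have : (Wᵀ * M).trace = (W * M).trace := by
      rw [← Matrix.trace_transpose, Matrix.transpose_mul, hMT, Matrix.transpose_transpose,
        Matrix.trace_mul_comm]
    rw [Matrix.add_mul, Matrix.trace_add, this, two_mul]
  have hpsd : (W + Wᵀ).PosSemidef := by
    refine .of_dotProduct_mulVec_nonneg hsym fun x => ?_
    have hx := posSemidef_vecMulVec_self_star x
    have h1 := hf' 0 _ isHermitian_zero hx
    have h2 := htwo _ hx.isHermitian
    rw [Matrix.mul_vecMulVec, Matrix.trace_vecMulVec, dotProduct_comm] at h2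
    rw [h2]
    simpa using h1
  refine absurd (hG.trace_nonneg hA hAB hpsd (Z := Z) ?_) (not_le.2 hneg)
  -- Symmetric `X` form a linear space, so the inequality for both `X` and `-X` is an equality.
  have hlin : ∀ X : Matrix (Fin k) (Fin k) ℝ, X.IsHermitian →
      (W * (X * A + Aᵀ * X)).trace + (Z * (X * B)).trace = 0 := by
    intro X hX
    have h1 := hf' X 0 hX .zero
    have h2 := hf' (-X) 0 hX.neg .zero
    simp only [add_zero, Matrix.neg_mul, Matrix.mul_neg, ← neg_add, Matrix.trace_neg] at h1 h2
    linarith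
  have hH := add_transpose_eq_zero_of_trace
    (H := (2⁻¹ : ℝ) • (A * (W + Wᵀ) + (W + Wᵀ) * Aᵀ) + B * Z) (by
      intro X hX
      have hXT : Xᵀ = X := by rw [← conjTranspose_eq_transpose_of_trivial]; exact hX
      rw [← hlin X hX, Matrix.mul_add, Matrix.trace_add]
      congr 1
      · have hM : (X * A + Aᵀ * X).IsHermitian := by
          rw [Matrix.IsHermitian, conjTranspose_eq_transpose_of_trivial]
          simp [hXT, add_comm]
        have h3 := htwo _ hM
        have h4 : (X * (A * (W + Wᵀ) + (W + Wᵀ) * Aᵀ)).trace =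
            ((W + Wᵀ) * (X * A + Aᵀ * X)).trace := by
          generalize W + Wᵀ = W'
          rw [Matrix.mul_add, Matrix.mul_add, Matrix.trace_add, Matrix.trace_add]
          congr 1
          · rw [← Matrix.mul_assoc, Matrix.trace_mul_comm]
          · rw [Matrix.trace_mul_comm, Matrix.mul_assoc]
        rw [Matrix.mul_smul, Matrix.trace_smul, h4, h3, smul_eq_mul]
        ring
      · rw [← Matrix.mul_assoc, Matrix.trace_mul_comm])
  have hWs : (W + Wᵀ)ᵀ = W + Wᵀ := by
    rw [← conjTranspose_eq_transpose_of_trivial]; exact hsym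
  rw [← hH]
  generalize W + Wᵀ = W' at hWs
  simp only [Matrix.transpose_add, Matrix.transpose_smul, Matrix.transpose_mul, hWs,
    Matrix.transpose_transpose]
  module

/-- The positive real lemma for strictly proper systems. -/
theorem IsPositiveReal.exists_posDef {A : Matrix (Fin k) (Fin k) ℝ}
    {B : Matrix (Fin k) (Fin n) ℝ} {C : Matrix (Fin n) (Fin k) ℝ} (hG : IsPositiveReal A B C)
    (hA : IsHurwitz A) (hAB : IsControllable A B) (hAC : IsControllable Aᵀ Cᵀ) :
    ∃ X : Matrix (Fin k) (Fin k) ℝ, X.PosDef ∧ (-(X * A + Aᵀ * X)).PosSemidef ∧ X * B = Cᵀ := by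
  obtain ⟨X, hX, hL, hC⟩ := hG.exists_kyp hA hAB
  refine ⟨X, hA.posDef_of_lyapunov hAC hX hL fun v hv => ?_, hL, hC⟩
  have hXT : Xᵀ = X := by rw [← conjTranspose_eq_transpose_of_trivial]; exact hX
  have : C = Bᵀ * X := by
    have := congrArg Matrix.transpose hC
    rw [Matrix.transpose_mul, hXT, Matrix.transpose_transpose] at this
    exact this.symm
  rw [this, ← mulVec_mulVec, hv, mulVec_zero]

end PositiveReal

/-! ### From negative imaginary to positive real and back. -/

section Main

variable {k n : ℕ}

theorem continuousAt_inv_of_isUnit {M : Matrix (Fin k) (Fin k) ℂ} (h : IsUnit M) :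
    ContinuousAt Inv.inv M := by
  refine continuousAt_matrix_inv M ?_
  rw [Ring.inverse_eq_inv']
  exact continuousAt_inv₀ ((Matrix.isUnit_iff_isUnit_det _).1 h).ne_zero

theorem IsHurwitz.isUnit_imaginary {A : Matrix (Fin k) (Fin k) ℝ} (h : IsHurwitz A) (ω : ℝ) :
    IsUnit ((Complex.I * ω) • 1 - A.map (algebraMap ℝ ℂ)) :=
  isHurwitz_iff.1 h _ (by simp)

theorem IsHurwitz.continuous_resolvent {A : Matrix (Fin k) (Fin k) ℝ} (h : IsHurwitz A) :
    Continuous fun ω : ℝ => ((Complex.I * ω) • 1 - A.map (algebraMap ℝ ℂ))⁻¹ := by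
  refine continuous_iff_continuousAt.2 fun ω => ?_
  exact ContinuousAt.comp (g := Inv.inv) (continuousAt_inv_of_isUnit (h.isUnit_imaginary ω))
    (by fun_prop)

/-- With `τ = (jω)⁻¹` the resolvent is `τ (1 - τ a)⁻¹`, which is continuous at `τ = 0`. -/
theorem tendsto_resolvent_atTop (a : Matrix (Fin k) (Fin k) ℂ) :
    Tendsto (fun ω : ℝ => ((Complex.I * ω) • 1 - a)⁻¹) atTop (𝓝 0) := by
  have hunit : ∀ᶠ τ : ℂ in 𝓝 0, (1 - τ • a).det ≠ 0 := by
    have hc : Continuous fun τ : ℂ => (1 - τ • a).det := by fun_prop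
    refine (hc.tendsto 0).eventually_ne ?_
    simp
  have hlim : Tendsto (fun τ : ℂ => τ • (1 - τ • a)⁻¹) (𝓝 0) (𝓝 0) := by
    have h1 : ContinuousAt (fun τ : ℂ => (1 - τ • a)⁻¹) 0 :=
      ContinuousAt.comp (g := Inv.inv) (continuousAt_inv_of_isUnit (by simp)) (by fun_prop)
    have := (tendsto_id (x := 𝓝 (0 : ℂ))).smul h1
    rwa [zero_smul] at this
  have hτ : Tendsto (fun ω : ℝ => (Complex.I * ω)⁻¹) atTop (𝓝 0) := by
    have : Tendsto (fun ω : ℝ => (ω⁻¹ : ℝ) * Complex.I⁻¹) atTop (𝓝 (((0 : ℝ) : ℂ) * Complex.I⁻¹)) :=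
      ((Complex.continuous_ofReal.tendsto 0).comp tendsto_inv_atTop_zero).mul_const _
    simpa [mul_comm] using this
  refine (hlim.comp hτ).congr' ?_
  filter_upwards [hτ.eventually hunit, eventually_gt_atTop 0] with ω h1 h2
  refine (Matrix.inv_eq_right_inv ?_).symm
  have h3 : Complex.I * ω ≠ 0 := by simp [h2.ne']
  rw [Function.comp_apply, Matrix.mul_smul, ← Matrix.smul_mul, smul_sub, smul_smul,
    inv_mul_cancel₀ h3, one_smul, Matrix.mul_nonsing_inv _ (isUnit_iff_ne_zero.2 h1)]

/-- The frequency response of a state-space realisation. -/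
noncomputable def freqResponse (A : Matrix (Fin k) (Fin k) ℝ) (B : Matrix (Fin k) (Fin n) ℝ)
    (C : Matrix (Fin n) (Fin k) ℝ) (D : Matrix (Fin n) (Fin n) ℝ) (ω : ℝ) :
    Matrix (Fin n) (Fin n) ℂ :=
  C.map (algebraMap ℝ ℂ) * ((Complex.I * ω) • 1 - A.map (algebraMap ℝ ℂ))⁻¹ *
    B.map (algebraMap ℝ ℂ) + D.map (algebraMap ℝ ℂ)

theorem isSymm_of_im_nonpos {M : Matrix (Fin n) (Fin n) ℝ}
    (h : ∀ u : Fin n → ℂ, (star u ⬝ᵥ M.map (algebraMap ℝ ℂ) *ᵥ u).im ≤ 0) : M = Mᵀ := by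
  have h1 : ∀ i j, M i j ≤ M j i := by
    intro i j
    -- At `e_i + j e_j` the imaginary part of the form is `M i j - M j i`.
    have := h (Pi.single i 1 + Complex.I • Pi.single j 1)
    simp [mulVec_add, mulVec_smul] at this
    linarith
  ext i j
  exact le_antisymm (h1 i j) (h1 j i)

theorem quadForm_I_smul_sub_conjTranspose (H : Matrix (Fin n) (Fin n) ℂ) (u : Fin n → ℂ) :
    star u ⬝ᵥ (Complex.I • (H - Hᴴ)) *ᵥ u = ((-2 * (star u ⬝ᵥ H *ᵥ u).im : ℝ) : ℂ) := by
  have h1 : star u ⬝ᵥ Hᴴ *ᵥ u = star (star u ⬝ᵥ H *ᵥ u) := by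
    rw [Matrix.star_dotProduct, star_mulVec, conjTranspose_conjTranspose, ← dotProduct_mulVec]
  rw [smul_mulVec, dotProduct_smul, sub_mulVec, dotProduct_sub, h1]
  generalize star u ⬝ᵥ H *ᵥ u = z
  apply Complex.ext
  · simp; ring
  · simp

theorem im_nonpos_of_posSemidef {H : Matrix (Fin n) (Fin n) ℂ}
    (h : (Complex.I • (H - Hᴴ)).PosSemidef) (u : Fin n → ℂ) : (star u ⬝ᵥ H *ᵥ u).im ≤ 0 := by
  have := h.dotProduct_mulVec_nonneg u
  rw [quadForm_I_smul_sub_conjTranspose, Complex.zero_le_real] at this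
  linarith

theorem star_map_quadForm (M : Matrix (Fin n) (Fin n) ℂ) (u : Fin n → ℂ) :
    star (star u ⬝ᵥ M *ᵥ u) = star (star u) ⬝ᵥ M.map star *ᵥ star u := by
  simp [dotProduct, mulVec, Finset.mul_sum]

theorem IsPositiveReal.transpose {A : Matrix (Fin k) (Fin k) ℝ}
    {B : Matrix (Fin k) (Fin n) ℝ} {C : Matrix (Fin n) (Fin k) ℝ} (h : IsPositiveReal A B C) :
    IsPositiveReal Aᵀ Cᵀ Bᵀ := by
  intro ω u
  have h1 := h ω (star u)
  set G := C.map (algebraMap ℝ ℂ) *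
    ((Complex.I * ω) • 1 - A.map (algebraMap ℝ ℂ))⁻¹ * B.map (algebraMap ℝ ℂ) with hG
  have h2 : Bᵀ.map (algebraMap ℝ ℂ) * ((Complex.I * ω) • 1 - Aᵀ.map (algebraMap ℝ ℂ))⁻¹ *
      Cᵀ.map (algebraMap ℝ ℂ) = Gᵀ := by
    rw [hG]
    simp only [Matrix.transpose_mul, Matrix.transpose_nonsing_inv, Matrix.transpose_sub,
      Matrix.transpose_smul, Matrix.transpose_one, Matrix.transpose_map, Matrix.mul_assoc]
  rw [h2, mulVec_transpose, dotProduct_comm, ← dotProduct_mulVec]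
  rwa [star_star] at h1

/-- Negative frequencies follow by complex conjugation, as the matrices are real; `ω = 0` follows by
continuity. -/
theorem isPositiveReal_of_pos {A : Matrix (Fin k) (Fin k) ℝ}
    {B : Matrix (Fin k) (Fin n) ℝ} {C : Matrix (Fin n) (Fin k) ℝ} (hA : IsHurwitz A)
    (h : ∀ (ω : ℝ), 0 < ω → ∀ u : Fin n → ℂ, 0 ≤ (star u ⬝ᵥ (C.map (algebraMap ℝ ℂ) *
      ((Complex.I * ω) • 1 - A.map (algebraMap ℝ ℂ))⁻¹ * B.map (algebraMap ℝ ℂ)) *ᵥ u).re) :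
    IsPositiveReal A B C := by
  intro ω u
  rcases lt_trichotomy ω 0 with hω | rfl | hω
  · have h1 := h (-ω) (neg_pos.2 hω) (star u)
    rw [← Complex.conj_re] at h1
    change 0 ≤ (star _ : ℂ).re at h1
    rw [star_map_quadForm, star_star u] at h1
    convert h1 using 5
    have hmap : ∀ {p q : ℕ} (L : Matrix (Fin p) (Fin q) ℝ),
        (L.map (algebraMap ℝ ℂ)).map (starRingEnd ℂ) = L.map (algebraMap ℝ ℂ) := fun L => by
      ext i j; simp
    change _ = Matrix.map _ (starRingEnd ℂ)
    rw [Matrix.map_mul, Matrix.map_mul, hmap, hmap]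
    congr 2
    have hu := Matrix.nonsing_inv_mul _
      ((Matrix.isUnit_iff_isUnit_det _).1 (hA.isUnit_imaginary (-ω)))
    have hu := congrArg (starRingEnd ℂ).mapMatrix hu
    rw [map_mul, map_one, RingHom.mapMatrix_apply, RingHom.mapMatrix_apply] at hu
    refine Matrix.inv_eq_left_inv ((congrArg _ ?_).trans hu)
    ext i j
    by_cases hij : i = j
    · subst hij; simp
    · simp [hij]
  · have hc : Continuous fun ω : ℝ => (star u ⬝ᵥ (C.map (algebraMap ℝ ℂ) *
        ((Complex.I * ω) • 1 - A.map (algebraMap ℝ ℂ))⁻¹ * B.map (algebraMap ℝ ℂ)) *ᵥ u).re := by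
      have := hA.continuous_resolvent
      fun_prop
    exact ge_of_tendsto ((hc.tendsto 0).mono_left (nhdsWithin_le_nhds (s := Set.Ioi 0)))
      (eventually_mem_nhdsWithin.mono fun ω hω => h ω hω u)
  · exact h ω hω u

/-- Write `B = A (A⁻¹ B)` and use `Φ A = jω Φ - 1` for the resolvent `Φ`. -/
theorem IsHurwitz.freqResponse_eq {A : Matrix (Fin k) (Fin k) ℝ} (hA : IsHurwitz A)
    (B : Matrix (Fin k) (Fin n) ℝ) (C : Matrix (Fin n) (Fin k) ℝ) (D : Matrix (Fin n) (Fin n) ℝ)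
    (ω : ℝ) :
    freqResponse A B C D ω = (D - C * A⁻¹ * B).map (algebraMap ℝ ℂ) -
      (Complex.I * ω) • (C.map (algebraMap ℝ ℂ) *
        ((Complex.I * ω) • 1 - A.map (algebraMap ℝ ℂ))⁻¹ *
          (-(A⁻¹ * B)).map (algebraMap ℝ ℂ)) := by
  have hB : B = A * (A⁻¹ * B) := by
    rw [← Matrix.mul_assoc, Matrix.mul_nonsing_inv _ hA.isUnit_det, Matrix.one_mul]
  have hu := Matrix.nonsing_inv_mul _ ((Matrix.isUnit_iff_isUnit_det _).1 (hA.isUnit_imaginary ω))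
  unfold freqResponse
  set Φ := ((Complex.I * ω) • 1 - A.map (algebraMap ℝ ℂ))⁻¹
  have hΦ : Φ * A.map (algebraMap ℝ ℂ) = (Complex.I * ω) • Φ - 1 := by
    rw [Matrix.mul_sub, Matrix.mul_smul, Matrix.mul_one] at hu
    rw [← hu]; abel
  have hneg : (-(A⁻¹ * B)).map (algebraMap ℝ ℂ) = -(A⁻¹ * B).map (algebraMap ℝ ℂ) := by
    ext i j; simp
  have hsub : (D - C * A⁻¹ * B).map (algebraMap ℝ ℂ) = D.map (algebraMap ℝ ℂ) -
      C.map (algebraMap ℝ ℂ) * (A⁻¹ * B).map (algebraMap ℝ ℂ) := by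
    rw [← Matrix.map_mul, ← Matrix.mul_assoc]
    ext i j; simp
  conv_lhs => rw [hB, Matrix.map_mul, Matrix.mul_assoc, ← Matrix.mul_assoc Φ, hΦ]
  rw [hneg, hsub, Matrix.sub_mul, Matrix.mul_sub, Matrix.one_mul, Matrix.smul_mul, Matrix.mul_smul,
    Matrix.mul_neg, Matrix.mul_assoc, smul_neg]
  abel

theorem evalAt_transferMatrix_eq_freqResponse {A : Matrix (Fin k) (Fin k) ℝ} (hA : IsHurwitz A)
    (B : Matrix (Fin k) (Fin n) ℝ) (C : Matrix (Fin n) (Fin k) ℝ) (D : Matrix (Fin n) (Fin n) ℝ)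
    (ω : ℝ) : evalAt (transferMatrix A B C D) (Complex.I * ω) = freqResponse A B C D ω :=
  hA.evalAt_transferMatrix B C D (by simp)

theorem feedthrough_isSymm {A : Matrix (Fin k) (Fin k) ℝ} {B : Matrix (Fin k) (Fin n) ℝ}
    {C : Matrix (Fin n) (Fin k) ℝ} {D : Matrix (Fin n) (Fin n) ℝ}
    (h : ∀ ω : ℝ, 0 < ω → ∀ u : Fin n → ℂ, (star u ⬝ᵥ freqResponse A B C D ω *ᵥ u).im ≤ 0) :
    D = Dᵀ := by
  refine isSymm_of_im_nonpos fun u => ?_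
  have hc : Continuous fun Φ : Matrix (Fin k) (Fin k) ℂ =>
      (star u ⬝ᵥ (C.map (algebraMap ℝ ℂ) * Φ * B.map (algebraMap ℝ ℂ) +
        D.map (algebraMap ℝ ℂ)) *ᵥ u).im := by fun_prop
  have hlim := (hc.tendsto 0).comp (tendsto_resolvent_atTop (A.map (algebraMap ℝ ℂ)))
  rw [Matrix.mul_zero, Matrix.zero_mul, zero_add] at hlim
  exact le_of_tendsto hlim ((eventually_gt_atTop 0).mono fun ω hω => h ω hω u)

theorem dcGain_isSymm {A : Matrix (Fin k) (Fin k) ℝ} (hA : IsHurwitz A)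
    {B : Matrix (Fin k) (Fin n) ℝ} {C : Matrix (Fin n) (Fin k) ℝ} {D : Matrix (Fin n) (Fin n) ℝ}
    (h : ∀ ω : ℝ, 0 < ω → ∀ u : Fin n → ℂ, (star u ⬝ᵥ freqResponse A B C D ω *ᵥ u).im ≤ 0) :
    D - C * A⁻¹ * B = (D - C * A⁻¹ * B)ᵀ := by
  refine isSymm_of_im_nonpos fun u => ?_
  have hc : Continuous fun ω : ℝ => (star u ⬝ᵥ freqResponse A B C D ω *ᵥ u).im := by
    have := hA.continuous_resolvent
    unfold freqResponse
    fun_prop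
  have hlim := (hc.tendsto 0).mono_left (nhdsWithin_le_nhds (s := Set.Ioi 0))
  rw [hA.freqResponse_eq, Complex.ofReal_zero, mul_zero, zero_smul, sub_zero] at hlim
  exact le_of_tendsto hlim (eventually_mem_nhdsWithin.mono fun ω hω => h ω hω u)

/-- The symmetric DC gain contributes nothing to the imaginary part, leaving `-ω` times the real
part of the form of `G`. -/
theorem isPositiveReal_of_negImag {A : Matrix (Fin k) (Fin k) ℝ} (hA : IsHurwitz A)
    {B : Matrix (Fin k) (Fin n) ℝ} {C : Matrix (Fin n) (Fin k) ℝ} {D : Matrix (Fin n) (Fin n) ℝ}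
    (h : ∀ ω : ℝ, 0 < ω → ∀ u : Fin n → ℂ, (star u ⬝ᵥ freqResponse A B C D ω *ᵥ u).im ≤ 0) :
    IsPositiveReal A (-(A⁻¹ * B)) C := by
  refine isPositiveReal_of_pos hA fun ω hω u => ?_
  have h1 := h ω hω u
  have hsym := dcGain_isSymm hA h
  rw [hA.freqResponse_eq, sub_mulVec, dotProduct_sub, smul_mulVec, dotProduct_smul] at h1
  have h0 : (star u ⬝ᵥ (D - C * A⁻¹ * B).map (algebraMap ℝ ℂ) *ᵥ u).im = 0 := by
    have : ((D - C * A⁻¹ * B).map (algebraMap ℝ ℂ)).IsHermitian := by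
      rw [Matrix.IsHermitian, conjTranspose_map_algebraMap, ← hsym]
    exact this.im_star_dotProduct_mulVec_self u
  rw [Complex.sub_im, h0] at h1
  simp only [smul_eq_mul, Complex.mul_im, Complex.mul_re, Complex.I_re, Complex.I_im,
    Complex.ofReal_re, Complex.ofReal_im] at h1
  nlinarith

theorem posSemidef_map {M : Matrix (Fin k) (Fin k) ℝ} (h : M.PosSemidef) :
    (M.map (algebraMap ℝ ℂ)).PosSemidef := by
  obtain ⟨V, rfl⟩ := exists_eq_mul_transpose h
  rw [Matrix.map_mul, ← conjTranspose_map_algebraMap]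
  exact posSemidef_self_mul_conjTranspose _

theorem posSemidef_freqResponse {A : Matrix (Fin k) (Fin k) ℝ} (hA : IsHurwitz A)
    {B : Matrix (Fin k) (Fin n) ℝ} {C : Matrix (Fin n) (Fin k) ℝ} {D : Matrix (Fin n) (Fin n) ℝ}
    (hD : D = Dᵀ) {Y : Matrix (Fin k) (Fin k) ℝ} (hY : Y.IsHermitian)
    (hL : (-(A * Y + Y * Aᵀ)).PosSemidef) (hB : B = -(A * Y * Cᵀ)) {ω : ℝ} (hω : 0 < ω) :
    (Complex.I • (freqResponse A B C D ω - (freqResponse A B C D ω)ᴴ)).PosSemidef := by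
  have hB' : -(A⁻¹ * B) = Y * Cᵀ := by
    rw [hB, Matrix.mul_neg, neg_neg, Matrix.mul_assoc, ← Matrix.mul_assoc A⁻¹,
      Matrix.nonsing_inv_mul _ hA.isUnit_det, Matrix.one_mul]
  have hdet := (Matrix.isUnit_iff_isUnit_det _).1 (hA.isUnit_imaginary ω)
  have hu := Matrix.nonsing_inv_mul _ hdet
  have hYT : Yᵀ = Y := by rw [← conjTranspose_eq_transpose_of_trivial]; exact hY
  have hy : (Y.map (algebraMap ℝ ℂ))ᴴ = Y.map (algebraMap ℝ ℂ) := by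
    rw [conjTranspose_map_algebraMap, hYT]
  have hM := posSemidef_map hL
  have hsym : ((D - C * A⁻¹ * B).map (algebraMap ℝ ℂ))ᴴ =
      (D - C * A⁻¹ * B).map (algebraMap ℝ ℂ) := by
    have : D - C * A⁻¹ * B = D + C * (Y * Cᵀ) := by
      rw [← hB', Matrix.mul_neg, Matrix.mul_assoc, sub_eq_add_neg]
    rw [conjTranspose_map_algebraMap, this, Matrix.transpose_add, ← hD, Matrix.transpose_mul, Matrix.transpose_mul,
      Matrix.transpose_transpose, hYT, Matrix.mul_assoc]
  rw [hA.freqResponse_eq, hB', conjTranspose_sub, hsym, sub_sub_sub_cancel_left, Matrix.map_mul,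
    ← conjTranspose_map_algebraMap]
  set a := A.map (algebraMap ℝ ℂ) with ha
  set c := C.map (algebraMap ℝ ℂ) with hc
  set y := Y.map (algebraMap ℝ ℂ) with hy'
  set Φ := ((Complex.I * ω) • 1 - a)⁻¹ with hΦ
  -- The terms `±jω y` cancel. Multiplying by `Φ` and `Φᴴ` then turns this into the formula for `Φ y
  -- + y Φᴴ`.
  have hM' : (-(A * Y + Y * Aᵀ)).map (algebraMap ℝ ℂ) =
      ((Complex.I * ω) • 1 - a) * y + y * ((Complex.I * ω) • 1 - a)ᴴ := by
    have e1 : (-(A * Y + Y * Aᵀ)).map (algebraMap ℝ ℂ) = -(a * y + y * aᴴ) := by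
      rw [ha, hy', conjTranspose_map_algebraMap, ← Matrix.map_mul, ← Matrix.map_mul]
      ext i j; simp
    rw [e1, conjTranspose_sub, conjTranspose_smul, conjTranspose_one, Matrix.sub_mul,
      Matrix.mul_sub, Matrix.smul_mul, Matrix.mul_smul, Matrix.one_mul, Matrix.mul_one]
    have : star (Complex.I * (ω : ℂ)) = -(Complex.I * ω) := by simp
    rw [this]
    module
  have hkey : Φ * y + y * Φᴴ = Φ * (-(A * Y + Y * Aᵀ)).map (algebraMap ℝ ℂ) * Φᴴ := by
    have hu2 : ((Complex.I * ω) • 1 - a)ᴴ * Φᴴ = 1 := by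
      rw [← conjTranspose_mul, hu, conjTranspose_one]
    rw [hM', Matrix.mul_add, Matrix.add_mul, ← Matrix.mul_assoc Φ, hu, Matrix.one_mul,
      ← Matrix.mul_assoc, Matrix.mul_assoc _ _ Φᴴ, hu2, Matrix.mul_one, add_comm]
  have hfinal : Complex.I • (((Complex.I * ω) • (c * Φ * (y * cᴴ)))ᴴ -
      (Complex.I * ω) • (c * Φ * (y * cᴴ))) =
      (ω : ℂ) • (c * (Φ * (-(A * Y + Y * Aᵀ)).map (algebraMap ℝ ℂ) * Φᴴ) * cᴴ) := by
    rw [← hkey, conjTranspose_smul, conjTranspose_mul, conjTranspose_mul, conjTranspose_mul,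
      conjTranspose_conjTranspose, hy]
    have : star (Complex.I * (ω : ℂ)) = -(Complex.I * ω) := by simp
    rw [this, neg_smul, ← neg_add', smul_neg, ← smul_add, smul_smul, ← mul_assoc,
      Complex.I_mul_I, ← neg_smul, neg_mul, neg_neg, one_mul]
    congr 1
    rw [Matrix.mul_add, Matrix.add_mul, add_comm]
    simp only [Matrix.mul_assoc]
  rw [hfinal]
  exact ((hM.mul_mul_conjTranspose_same Φ).mul_mul_conjTranspose_same c).smul
    (by exact_mod_cast hω.le)

theorem IsControllable.inv_mul {A : Matrix (Fin k) (Fin k) ℝ} (hA : IsUnit A.det)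
    {B : Matrix (Fin k) (Fin n) ℝ} (h : IsControllable A B) : IsControllable A (-(A⁻¹ * B)) := by
  intro V hB hV
  refine h V (fun j => ?_) hV
  have h1 := V.neg_mem (hV _ (hB j))
  convert h1 using 1
  have : A *ᵥ (-(A⁻¹ * B)).col j = (A * -(A⁻¹ * B)).col j := rfl
  rw [this, Matrix.mul_neg, ← Matrix.mul_assoc, Matrix.mul_nonsing_inv _ hA, Matrix.one_mul]
  ext i; simp

end Main

end NegImag

theorem lemma1 {n k : ℕ} (A : Matrix (Fin k) (Fin k) ℝ) (B : Matrix (Fin k) (Fin n) ℝ)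
    (C : Matrix (Fin n) (Fin k) ℝ) (D : Matrix (Fin n) (Fin n) ℝ)
    (R : Matrix (Fin n) (Fin n) (RatFunc ℝ))
    (hmin : NegImag.IsMinimalRealisation A B C D R) :
    R ∈ NegImag.ClassC n ↔
      NegImag.IsHurwitz A ∧ D = Dᴴ ∧
        ∃ Y : Matrix (Fin k) (Fin k) ℝ, Y.PosDef ∧
          (-(A * Y + Y * Aᴴ)).PosSemidef ∧ B = -(A * Y * Cᴴ) := by
  open NegImag in
  simp only [Matrix.conjTranspose_eq_transpose_of_trivial]
  have hR : R = transferMatrix A B C D := hmin.1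
  constructor
  · rintro ⟨hstable, hfreq⟩
    have hA := hmin.isHurwitz hstable
    have him : ∀ ω : ℝ, 0 < ω → ∀ u : Fin n → ℂ,
        (star u ⬝ᵥ freqResponse A B C D ω *ᵥ u).im ≤ 0 := by
      intro ω hω u
      have := hfreq ω hω
      rw [hR, evalAt_transferMatrix_eq_freqResponse hA] at this
      exact im_nonpos_of_posSemidef this u
    refine ⟨hA, feedthrough_isSymm him, ?_⟩
    -- For the transposed system the certificate satisfies exactly the conditions on `Y`;
    -- untransposed, it would be a candidate for `Y⁻¹`.
    have hpr := (isPositiveReal_of_negImag hA him).transpose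
    obtain ⟨Y, hY, hL, hC⟩ := hpr.exists_posDef hA.transpose hmin.transpose.isControllable (by
      simpa only [Matrix.transpose_transpose] using hmin.isControllable.inv_mul hA.isUnit_det)
    rw [Matrix.transpose_transpose] at hL hC
    refine ⟨Y, hY, by rwa [add_comm], ?_⟩
    rw [Matrix.mul_assoc, hC, Matrix.mul_neg, neg_neg, ← Matrix.mul_assoc,
      Matrix.mul_nonsing_inv _ hA.isUnit_det, Matrix.one_mul]
  · rintro ⟨hA, hD, Y, hY, hL, hB⟩
    rw [hR]
    refine ⟨hA.transferMatrix_mem_RHInf B C D, fun ω hω => ?_⟩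
    rw [evalAt_transferMatrix_eq_freqResponse hA]
    exact posSemidef_freqResponse hA hD hY.isHermitian hL hB hω
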